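/- \textbf{Setting.} Let $\mathcal G=(\mathcal V,\mathcal E)$ be a finite, weakly connected directed multigraph without self-loops, with node-link incidence matrix $A\in\{-1,0,1\}^{\mathcal V\times\mathcal E}$ ($A_{vi}=+1$ if $v$ is the tail of $i$, $-1$ if $v$ is the head of $i$, $0$ otherwise). For $w\in\mathbb R_{>0}^{\mathcal E}$ put $W=\operatorname{diag}(w)$ and $L(w)=AWA^{T}$, with Moore--Penrose pseudo-inverse $L(w)^{\dagger}$. For two distinct nodes $v_1,v_2$ let $a=a_{v_1v_2}\in\mathbb R^{\mathcal V}$ have entry $+1$ at $v_1$, $-1$ at $v_2$ and $0$ elsewhere. The link flows under unit supply at $v_1$ and unit demand at $v_2$ are $f(w)=WA^{T}L(w)^{\dagger}a$, and the equivalent weight between $v_1$ and $v_2$ is $\mathcal H(w)=1/(a^{T}L(w)^{\dagger}a)$. The network is \emph{link reducible} (with respect to $v_1,v_2$) if the undirected multigraph underlying $\mathcal G$ can be transformed into a graph with exactly one link by finitely many of the following operations: (1) delete a vertex $v\notin\{v_1,v_2\}$ of degree one together with its link; (2) delete a vertex $v\notin\{v_1,v_2\}$ of degree two whose two links go to distinct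 vertices $x,y$, together with these links, and add a link $\{x,y\}$; (3) if two vertices are joined by several links, remove one of these links. A continuous function $\psi:[x^l,x^u]\to\mathbb R$ is $\mathcal S_0$ if there are $x^l\le\underline x\le\bar x\le x^u$ such that $\psi$ is strictly increasing on $[x^l,\underline x]$, constant on $[\underline x,\bar x]$ and strictly decreasing on $[\bar x,x^u]$. If $0<x^l$, then $\psi$ is $\mathcal S_1$ if it is $\mathcal S_0$ and there is $x^o\in[x^l,\underline x]$ such that $\min\partial\psi(x)>\psi(x)/x$ for $x\in[x^l,x^o)$ and $\min\partial\psi(x)=\psi(x)/x$ for $x\in[x^o,\underline x)$. Here $$\min\partial\psi(x)=\liminf_{y\to x,\;y\in[x^l,x^u],\;y\ne x}\frac{\psi(y)-\psi(x)}{y-x}\in[-\infty,\infty],$$ which is the smaller of the left and right derivatives of $\psi$ at $x$ whenever these exist (the only available one at an end point). \textbf{Theorem.} Let $\mathcal G$ be link reducible with respect to $v_1\neq v_2$, and let the links be directed along the flow, i.e. $f_i(w^0)\ge 0$ for all $i\in\mathcal E$ for some $w^0\in\mathbb R_{>0}^{\mathcal E}$. Let $0<w_i^l\le w_i^u$, and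 let the link capacity functions $c_i:[w_i^l,w_i^u]\to\mathbb R_{>0}$, $i\in\mathcal E$, be $\mathcal S_1$. Then for every $w_{\mathrm{eq}}\in[\mathcal H(w^l),\mathcal H(w^u)]$ the reduction problem $$\mathcal C(w_{\mathrm{eq}})=\max\{z\in\mathbb R:\ \exists\, w\in\mathbb R^{\mathcal E},\ w^l\le w\le w^u,\ z f_i(w)\le c_i(w_i)\ \forall i\in\mathcal E,\ \mathcal H(w)=w_{\mathrm{eq}}\}$$ has a solution (the maximum is attained), and the equivalent capacity function $\mathcal C:[\mathcal H(w^l),\mathcal H(w^u)]\to\mathbb R$ is an $\mathcal S_1$ function. -/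

import Mathlib

open Filter Topology

/-! ### Function classes on a compact interval -/

/-- `ψ` is an `S₀` function on `[xl, xu]` with first transition point `a` and second transition
point `b`. -/
structure IsS0With (xl xu : ℝ) (ψ : ℝ → ℝ) (a b : ℝ) : Prop where
  continuousOn : ContinuousOn ψ (Set.Icc xl xu)
  fst_mem : a ∈ Set.Icc xl xu
  snd_mem : b ∈ Set.Icc a xu
  strictMonoOn : StrictMonoOn ψ (Set.Icc xl a)
  const_on : ∀ x ∈ Set.Icc a b, ψ x = ψ a
  strictAntiOn : StrictAntiOn ψ (Set.Icc b xu)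

/-- `S₀` functions on `[xl, xu]`. -/
def IsS0 (xl xu : ℝ) (ψ : ℝ → ℝ) : Prop :=
  ∃ a b, IsS0With xl xu ψ a b

/-- The minimal subgradient `min ∂ψ(x)` of a function `ψ` on `[xl, xu]`: the lower limit, over
`y → x` with `y ∈ [xl, xu]` and `y ≠ x`, of the difference quotients of `ψ` at `x`.  When the
one-sided derivatives of `ψ` at `x` exist (finite or infinite) this is
`min {ψ'(x⁻), ψ'(x⁺)}`, and it is the only available one-sided derivative at an end point. -/
noncomputable def minSubgradient (xl xu : ℝ) (ψ : ℝ → ℝ) (x : ℝ) : EReal :=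
  liminf (fun y => (((ψ y - ψ x) / (y - x) : ℝ) : EReal)) (𝓝[Set.Icc xl xu \ {x}] x)

/-- `S₁` functions on `[xl, xu] ⊂ ℝ_{>0}`. -/
def IsS1 (xl xu : ℝ) (ψ : ℝ → ℝ) : Prop :=
  0 < xl ∧ ∃ a b, IsS0With xl xu ψ a b ∧
    ∃ xo ∈ Set.Icc xl a,
      (∀ x ∈ Set.Ico xl xo, ((ψ x / x : ℝ) : EReal) < minSubgradient xl xu ψ x) ∧
      (∀ x ∈ Set.Ico xo a, minSubgradient xl xu ψ x = ((ψ x / x : ℝ) : EReal))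

/-! ### The Moore–Penrose pseudo-inverse of a real square matrix -/

/-- The four Penrose conditions: `B` is the Moore–Penrose pseudo-inverse of `A`. -/
structure IsMoorePenrose {V : Type*} [Fintype V] (A B : Matrix V V ℝ) : Prop where
  mul_mul_self : A * B * A = A
  self_mul_mul : B * A * B = B
  left_symm : (A * B).transpose = A * B
  right_symm : (B * A).transpose = B * A

theorem IsMoorePenrose.unique {V : Type*} [Fintype V] {A B C : Matrix V V ℝ}
    (hB : IsMoorePenrose A B) (hC : IsMoorePenrose A C) : B = C := by
  have h1 : A * B = A * C := by
    calc A * B = (A * C) * (A * B) := by rw [← Matrix.mul_assoc, hC.mul_mul_self]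
      _ = (A * C).transpose * (A * B).transpose := by rw [hC.left_symm, hB.left_symm]
      _ = ((A * B) * (A * C)).transpose := by rw [Matrix.transpose_mul (A * B)]
      _ = (A * C).transpose := by rw [← Matrix.mul_assoc, hB.mul_mul_self]
      _ = A * C := hC.left_symm
  have h2 : B * A = C * A := by
    calc B * A = (B * A) * (C * A) := by
          rw [Matrix.mul_assoc B A, ← Matrix.mul_assoc A C, hC.mul_mul_self]
      _ = (B * A).transpose * (C * A).transpose := by rw [hB.right_symm, hC.right_symm]
      _ = ((C * A) * (B * A)).transpose := by rw [Matrix.transpose_mul (C * A)]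
      _ = (C * A).transpose := by
          rw [Matrix.mul_assoc C A, ← Matrix.mul_assoc A B, hB.mul_mul_self]
      _ = C * A := hC.right_symm
  calc B = B * A * B := hB.self_mul_mul.symm
    _ = C * A * C := by rw [h2, Matrix.mul_assoc, h1, ← Matrix.mul_assoc]
    _ = C := hC.self_mul_mul

/-- Every real symmetric matrix has a Moore–Penrose pseudo-inverse. -/
theorem exists_isMoorePenrose {V : Type*} [Fintype V] [DecidableEq V] (A : Matrix V V ℝ)
    (hA : A.transpose = A) : ∃ B, IsMoorePenrose A B := by
  have hA' : A.IsHermitian := by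
    rw [Matrix.IsHermitian, Matrix.conjTranspose_eq_transpose_of_trivial]; exact hA
  have hsa : IsSelfAdjoint A := hA'
  have hc : ∀ f : ℝ → ℝ, ContinuousOn f (spectrum ℝ A) := fun f =>
    (Matrix.finite_real_spectrum (A := A)).continuousOn f
  have hAi : A = cfc (fun x : ℝ => x) A := (cfc_id' ℝ A hsa).symm
  have hsym : ∀ f : ℝ → ℝ, (cfc f A).transpose = cfc f A := fun f => by
    have h : IsSelfAdjoint (cfc f A) := cfc_predicate f A
    rw [← Matrix.conjTranspose_eq_transpose_of_trivial]
    exact h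
  have hAB : A * cfc (fun x : ℝ => x⁻¹) A = cfc (fun x : ℝ => x * x⁻¹) A := by
    conv_lhs => rw [show A * cfc (fun x : ℝ => x⁻¹) A
      = cfc (fun x : ℝ => x) A * cfc (fun x : ℝ => x⁻¹) A by rw [← hAi]]
    exact (cfc_mul _ _ A (hc _) (hc _)).symm
  have hBA : cfc (fun x : ℝ => x⁻¹) A * A = cfc (fun x : ℝ => x⁻¹ * x) A := by
    conv_lhs => rw [show cfc (fun x : ℝ => x⁻¹) A * A
      = cfc (fun x : ℝ => x⁻¹) A * cfc (fun x : ℝ => x) A by rw [← hAi]]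
    exact (cfc_mul _ _ A (hc _) (hc _)).symm
  refine ⟨cfc (fun x : ℝ => x⁻¹) A, ?_, ?_, ?_, ?_⟩
  · rw [hAB]
    conv_lhs => rw [show cfc (fun x : ℝ => x * x⁻¹) A * A
      = cfc (fun x : ℝ => x * x⁻¹) A * cfc (fun x : ℝ => x) A by rw [← hAi]]
    rw [← cfc_mul _ _ A (hc _) (hc _)]
    conv_rhs => rw [hAi]
    congr 1
    funext x
    exact mul_inv_mul_cancel x
  · rw [hBA, ← cfc_mul _ _ A (hc _) (hc _)]
    congr 1
    funext x
    by_cases hx : x = 0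
    · simp [hx]
    · field_simp
  · rw [hAB]; exact hsym _
  · rw [hBA]; exact hsym _

open Classical in
/-- The Moore–Penrose pseudo-inverse. It exists for every symmetric matrix, and is unique. -/
noncomputable def pinv {V : Type*} [Fintype V] (A : Matrix V V ℝ) : Matrix V V ℝ :=
  if h : ∃ B, IsMoorePenrose A B then h.choose else 0

theorem pinv_spec {V : Type*} [Fintype V] [DecidableEq V] (A : Matrix V V ℝ)
    (hA : A.transpose = A) : IsMoorePenrose A (pinv A) := by
  have h := exists_isMoorePenrose A hA
  rw [pinv, dif_pos h]
  exact h.choose_spec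

/-! ### Networks -/

/-- A directed multigraph without self-loops, with node set `V` and link set `E`. -/
structure DirectedMultigraph (V E : Type*) where
  /-- the tail `σ(i)` of a link -/
  src : E → V
  /-- the head `τ(i)` of a link -/
  tgt : E → V
  loopless : ∀ i, src i ≠ tgt i

/-- The supply-demand vector `a_{st}` with a unit supply at `s` and a unit demand at `t`. -/
def dipole {V : Type*} [DecidableEq V] (s t : V) : V → ℝ :=
  Pi.single s 1 - Pi.single t 1

/-- An undirected multigraph: a finite set of vertices and a multiset of links, each link being an
unordered pair of vertices. -/
structure UndirectedMultigraph (V : Type*) where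
  verts : Finset V
  links : Multiset (Sym2 V)

/-- One reduction operation on an undirected multigraph with supply-demand vector `p`. -/
inductive ReductionStep {V : Type*} [DecidableEq V] (p : V → ℝ) :
    UndirectedMultigraph V → UndirectedMultigraph V → Prop
  /-- Degree-one reduction: delete a vertex `v` with `p v = 0` which is incident to exactly one
  link, and delete that link. -/
  | degreeOne (U : Finset V) (M : Multiset (Sym2 V)) (v u : V) (hvu : v ≠ u) (hp : p v = 0)
      (hM : ∀ l ∈ M, v ∉ l) :
      ReductionStep p ⟨U, s(v, u) ::ₘ M⟩ ⟨U.erase v, M⟩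
  /-- Series reduction: delete a vertex `v` with `p v = 0` which is incident to exactly two links,
  to two distinct vertices `a` and `b`, delete these links, and add a link between `a` and `b`. -/
  | series (U : Finset V) (M : Multiset (Sym2 V)) (a v b : V) (hav : a ≠ v) (hvb : v ≠ b)
      (hab : a ≠ b) (hp : p v = 0) (hM : ∀ l ∈ M, v ∉ l) :
      ReductionStep p ⟨U, s(a, v) ::ₘ s(v, b) ::ₘ M⟩ ⟨U.erase v, s(a, b) ::ₘ M⟩
  /-- Parallel reduction: remove one of several links between the same pair of vertices. -/
  | parallel (U : Finset V) (M : Multiset (Sym2 V)) (a b : V) (hab : a ≠ b) :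
      ReductionStep p ⟨U, s(a, b) ::ₘ s(a, b) ::ₘ M⟩ ⟨U, s(a, b) ::ₘ M⟩

namespace DirectedMultigraph

/-- Weak connectivity. -/
def WeaklyConnected {V E : Type*} (G : DirectedMultigraph V E) : Prop :=
  (SimpleGraph.fromRel fun u v => ∃ i, G.src i = u ∧ G.tgt i = v).Connected

/-- The undirected multigraph underlying `G`. -/
def underlying {V E : Type*} [Fintype V] [Fintype E] (G : DirectedMultigraph V E) :
    UndirectedMultigraph V :=
  ⟨Finset.univ, (Finset.univ : Finset E).val.map fun i => s(G.src i, G.tgt i)⟩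

/-- `G` with supply-demand vector `p` is link reducible: finitely many reduction operations lead to
a network with a single link. -/
def LinkReducible {V E : Type*} [Fintype V] [DecidableEq V] [Fintype E]
    (G : DirectedMultigraph V E) (p : V → ℝ) : Prop :=
  ∃ T, Relation.ReflTransGen (ReductionStep p) G.underlying T ∧ T.links.card = 1

/-- The node-link incidence matrix. -/
def incidence {V E : Type*} [DecidableEq V] (G : DirectedMultigraph V E) : Matrix V E ℝ :=
  fun v i => if v = G.tgt i then -1 else if v = G.src i then 1 else 0

/-- The weighted Laplacian `A W Aᵀ`. -/
def laplacian {V E : Type*} [DecidableEq V] [Fintype E] [DecidableEq E]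
    (G : DirectedMultigraph V E) (w : E → ℝ) : Matrix V V ℝ :=
  G.incidence * Matrix.diagonal w * G.incidence.transpose

/-- The link flows `f(w, p) = W Aᵀ L† p`. -/
noncomputable def flow {V E : Type*} [Fintype V] [DecidableEq V] [Fintype E] [DecidableEq E]
    (G : DirectedMultigraph V E) (w : E → ℝ) (p : V → ℝ) : E → ℝ :=
  (Matrix.diagonal w * G.incidence.transpose * pinv (G.laplacian w)).mulVec p

/-- The equivalent weight `H(w) = 1 / (aᵀ L† a)` between `s` and `t`, where `a = a_{st}`. -/
noncomputable def eqWeight {V E : Type*} [Fintype V] [DecidableEq V] [Fintype E] [DecidableEq E]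
    (G : DirectedMultigraph V E) (s t : V) (w : E → ℝ) : ℝ :=
  1 / (dipole s t ⬝ᵥ (pinv (G.laplacian w)).mulVec (dipole s t))

/-- The values `z` which are feasible in the reduction problem for the equivalent weight `weq`.
The constraint `z ≤ cᵢ(wᵢ) / fᵢ` is written as `z fᵢ ≤ cᵢ(wᵢ)`, so that it is void (for `cᵢ > 0`)
on a link without flow. -/
def reductionFeasible {V E : Type*} [Fintype V] [DecidableEq V] [Fintype E] [DecidableEq E]
    (G : DirectedMultigraph V E) (s t : V) (wl wu : E → ℝ) (c : E → ℝ → ℝ) (weq : ℝ) : Set ℝ :=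
  {z | ∃ w : E → ℝ, (∀ i, wl i ≤ w i ∧ w i ≤ wu i) ∧
    (∀ i, z * G.flow w (dipole s t) i ≤ c i (w i)) ∧ G.eqWeight s t w = weq}

/-- The solution function `C(weq)` of the reduction problem: the maximum of the feasible values
(the theorem asserts that it is attained). -/
noncomputable def equivalentCapacity {V E : Type*} [Fintype V] [DecidableEq V] [Fintype E]
    [DecidableEq E] (G : DirectedMultigraph V E) (s t : V) (wl wu : E → ℝ) (c : E → ℝ → ℝ)
    (weq : ℝ) : ℝ :=
  sSup (G.reductionFeasible s t wl wu c weq)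

end DirectedMultigraph

/-! Degree-one, series and parallel reductions respect Kirchhoff's laws, so a link reducible network
is a series-parallel tree on some of its links, and the other links carry no flow
(`DirectedMultigraph.exists_spTree`). By induction on the tree, it suffices that the positive S₁
functions are stable under parallel and series composition of two links.

The key is the ratio `C x / x`. By `slope_div_self`, the S₁ condition says that the ratio increases
strictly with positive lower derivative on `[l, o)` and is constant on `[o, a]` (`IsS1.isCapacity`,
`IsCapacity.isS1`); the ratio is then itself S₀ with plateau `[o, a]`. In parallel, weights add and
the flow splits in proportion to them, so the ratio of the composition is the max-min convolution of
the two ratios. S₀ amounts to continuity and strict quasiconcavity, and the convolution preserves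
both. It remains to see that the capacity is constant and then strictly decreasing beyond the
plateau of the ratio. There an optimal splitting uses the last points at which the two ratios reach
the common level, and neither link flow grows as the total weight grows
(`CapProfile.exists_parallel`).

The substitution `r = x⁻¹`, `D r = r * C r⁻¹` exchanges a capacity with its ratio and turns series
into parallel composition (`CapProfile.dual`). It also exchanges the increasing part of the ratio
with the decreasing part of the capacity, so steepness is tracked at both ends.

Finally, flow directions in a tree do not depend on the weights (`SPTree.exists_sign`), so an
orientation along one flow is an orientation along all of them. -/

/-! ### Strict quasiconcavity and the classes `S₀` -/

/-- A strict form of quasiconcavity: strictly between two points of `I` the function exceeds every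
level which it reaches at both points and exceeds at one of them. -/
def StrictQuasi (I : Set ℝ) (ψ : ℝ → ℝ) : Prop :=
  ∀ x ∈ I, ∀ z ∈ I, ∀ y ∈ openSegment ℝ x z, ∀ m, m ≤ ψ x → m < ψ z → m < ψ y

namespace IsS0With

variable {l u a b : ℝ} {ψ : ℝ → ℝ}

theorem le_apply_fst (h : IsS0With l u ψ a b) {x : ℝ} (hx : x ∈ Set.Icc l u) : ψ x ≤ ψ a := by
  have ha := h.fst_mem
  have hb := h.snd_mem
  rcases le_total x a with hxa | hxa
  · exact h.strictMonoOn.monotoneOn ⟨hx.1, hxa⟩ ⟨ha.1, le_rfl⟩ hxa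
  · rcases le_total x b with hxb | hxb
    · exact (h.const_on x ⟨hxa, hxb⟩).le
    · rw [← h.const_on b ⟨hb.1, le_rfl⟩]
      exact h.strictAntiOn.antitoneOn ⟨le_rfl, hb.2⟩ ⟨hxb, hx.2⟩ hxb

theorem antitoneOn (h : IsS0With l u ψ a b) : AntitoneOn ψ (Set.Icc a u) := by
  intro x hx y hy hxy
  rcases le_total x b with hxb | hxb
  · rw [h.const_on x ⟨hx.1, hxb⟩]
    exact h.le_apply_fst ⟨h.fst_mem.1.trans hy.1, hy.2⟩
  · exact h.strictAntiOn.antitoneOn ⟨hxb, hx.2⟩ ⟨hxb.trans hxy, hy.2⟩ hxy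

theorem lt_of_between (h : IsS0With l u ψ a b) {x y z m : ℝ} (hx : x ∈ Set.Icc l u)
    (hz : z ∈ Set.Icc l u) (hxy : x < y) (hyz : y < z) (hmx : m ≤ ψ x) (hmz : m ≤ ψ z)
    (hm : m < ψ x ∨ m < ψ z) : m < ψ y := by
  rcases le_total y a with hya | hya
  · exact hmx.trans_lt
      (h.strictMonoOn ⟨hx.1, hxy.le.trans hya⟩ ⟨hx.1.trans hxy.le, hya⟩ hxy)
  rcases le_total b y with hby | hby
  · exact hmz.trans_lt
      (h.strictAntiOn ⟨hby, hyz.le.trans hz.2⟩ ⟨hby.trans hyz.le, hz.2⟩ hyz)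
  · rw [h.const_on y ⟨hya, hby⟩]
    exact hm.elim (fun h1 => h1.trans_le (h.le_apply_fst hx))
      (fun h1 => h1.trans_le (h.le_apply_fst hz))

theorem strictQuasi (h : IsS0With l u ψ a b) : StrictQuasi (Set.Icc l u) ψ := by
  intro x hx z hz y hy m hmx hmz
  rcases lt_trichotomy x z with hxz | rfl | hxz
  · rw [openSegment_eq_Ioo hxz] at hy
    exact h.lt_of_between hx hz hy.1 hy.2 hmx hmz.le (Or.inr hmz)
  · rw [openSegment_same] at hy
    rwa [Set.mem_singleton_iff.1 hy]
  · rw [openSegment_symm, openSegment_eq_Ioo hxz] at hy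
    exact h.lt_of_between hz hx hy.1 hy.2 hmz.le hmx (Or.inl hmz)

end IsS0With

/-- The transition points are the first and the last maximiser; quasiconcavity with `m` equal to the
smaller value gives strict monotonicity outside them. -/
theorem StrictQuasi.exists_isS0With {l u : ℝ} {ψ : ℝ → ℝ} (hlu : l ≤ u)
    (hψ : StrictQuasi (Set.Icc l u) ψ) (hc : ContinuousOn ψ (Set.Icc l u)) :
    ∃ a b, IsS0With l u ψ a b := by
  obtain ⟨p, hp, hmax⟩ := isCompact_Icc.exists_isMaxOn ⟨l, le_rfl, hlu⟩ hc
  set A := Set.Icc l u ∩ ψ ⁻¹' {ψ p} with hA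
  have hAc : IsCompact A :=
    isCompact_Icc.of_isClosed_subset (hc.preimage_isClosed_of_isClosed isClosed_Icc
      isClosed_singleton) Set.inter_subset_left
  have hAn : A.Nonempty := ⟨p, hp, rfl⟩
  obtain ⟨a, haA, ha⟩ := hAc.exists_isLeast hAn
  obtain ⟨b, hbA, hb⟩ := hAc.exists_isGreatest hAn
  have hmax' : ∀ x ∈ Set.Icc l u, ψ x ≤ ψ p := fun x hx => hmax hx
  have haψ : ψ a = ψ p := haA.2
  have hbψ : ψ b = ψ p := hbA.2
  have hab : a ≤ b := ha hbA
  refine ⟨a, b, hc, haA.1, ⟨hab, hbA.1.2⟩, ?_, ?_, ?_⟩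
  · intro x hx y hy hxy
    have hxI : x ∈ Set.Icc l u := ⟨hx.1, hx.2.trans haA.1.2⟩
    have hxlt : ψ x < ψ a := by
      refine lt_of_le_of_ne (haψ ▸ hmax' x hxI) fun he => ?_
      exact absurd (ha ⟨hxI, he.trans haψ⟩) (not_le.2 (hxy.trans_le hy.2))
    rcases hy.2.eq_or_lt with rfl | hya
    · exact hxlt
    · refine hψ x hxI a haA.1 y ?_ _ le_rfl hxlt
      rw [openSegment_eq_Ioo (hxy.trans hya)]
      exact ⟨hxy, hya⟩
  · intro x hx
    rcases hx.1.eq_or_lt with rfl | hax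
    · rfl
    rcases hx.2.eq_or_lt with rfl | hxb
    · rw [haψ, hbψ]
    -- Quasiconcavity only puts interior values above every `m` below the maximum, hence the passage
    -- through all such `m`.
    refine le_antisymm ?_ (le_of_forall_lt fun m hm => ?_)
    · rw [haψ]
      exact hmax' x ⟨haA.1.1.trans hx.1, hx.2.trans hbA.1.2⟩
    · refine hψ a haA.1 b hbA.1 x ?_ m hm.le (by rwa [hbψ, ← haψ])
      rw [openSegment_eq_Ioo (hax.trans hxb)]
      exact ⟨hax, hxb⟩
  · intro x hx y hy hxy
    have hyI : y ∈ Set.Icc l u := ⟨hbA.1.1.trans hy.1, hy.2⟩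
    have hylt : ψ y < ψ b := by
      refine lt_of_le_of_ne (hbψ ▸ hmax' y hyI) fun he => ?_
      exact absurd (hb ⟨hyI, he.trans hbψ⟩) (not_le.2 (hx.1.trans_lt hxy))
    rcases hx.1.eq_or_lt with rfl | hbx
    · exact hylt
    · refine hψ y hyI b hbA.1 x ?_ _ le_rfl hylt
      rw [openSegment_symm, openSegment_eq_Ioo (hbx.trans hxy)]
      exact ⟨hbx, hxy⟩

/-- The max-min convolution of two continuous functions on compact intervals, described by its
hypograph. -/
theorem exists_maxMin_convolution {l₁ u₁ l₂ u₂ : ℝ} {g₁ g₂ : ℝ → ℝ} (h₁ : l₁ ≤ u₁) (h₂ : l₂ ≤ u₂)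
    (hg₁ : ContinuousOn g₁ (Set.Icc l₁ u₁)) (hg₂ : ContinuousOn g₂ (Set.Icc l₂ u₂)) :
    ∃ G : ℝ → ℝ, Continuous G ∧ ∀ x m,
      (∃ x₁ ∈ Set.Icc l₁ u₁, ∃ x₂ ∈ Set.Icc l₂ u₂, x₁ + x₂ = x ∧ m ≤ g₁ x₁ ∧ m ≤ g₂ x₂) ↔
        x ∈ Set.Icc (l₁ + l₂) (u₁ + u₂) ∧ m ≤ G x := by
  have hG₁ : Continuous (Set.IccExtend h₁ (Set.domRestrict (Set.Icc l₁ u₁) g₁)) :=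
    hg₁.domRestrict.Icc_extend'
  have hG₂ : Continuous (Set.IccExtend h₂ (Set.domRestrict (Set.Icc l₂ u₂) g₂)) :=
    hg₂.domRestrict.Icc_extend'
  have hE₁ : ∀ x ∈ Set.Icc l₁ u₁, Set.IccExtend h₁ (Set.domRestrict (Set.Icc l₁ u₁) g₁) x = g₁ x :=
    fun x hx => by rw [Set.IccExtend_of_mem _ _ hx]; rfl
  have hE₂ : ∀ x ∈ Set.Icc l₂ u₂, Set.IccExtend h₂ (Set.domRestrict (Set.Icc l₂ u₂) g₂) x = g₂ x :=
    fun x hx => by rw [Set.IccExtend_of_mem _ _ hx]; rfl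
  generalize Set.IccExtend h₁ (Set.domRestrict (Set.Icc l₁ u₁) g₁) = G₁ at hG₁ hE₁
  generalize Set.IccExtend h₂ (Set.domRestrict (Set.Icc l₂ u₂) g₂) = G₂ at hG₂ hE₂
  -- As `t` runs over `[0, 1]`, `p x t` runs over the admissible first summands of `x`. The supremum
  -- is thus over a fixed compact interval, which gives its continuity.
  let p : ℝ → ℝ → ℝ := fun x t =>
    max l₁ (x - u₂) + t * (min u₁ (x - l₂) - max l₁ (x - u₂))
  let f : ℝ → ℝ → ℝ := fun x t => min (G₁ (p x t)) (G₂ (x - p x t))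
  have hf : Continuous (Function.uncurry f) := by
    simp only [f, p, Function.uncurry_def]
    fun_prop
  have hfx : ∀ x, ContinuousOn (f x) (Set.Icc 0 1) := fun x => by
    have : Continuous (f x) := by
      simp only [f, p]
      fun_prop
    exact this.continuousOn
  refine ⟨fun x => sSup (f x '' Set.Icc 0 1), isCompact_Icc.continuous_sSup hf, fun x m => ⟨?_, ?_⟩⟩
  · rintro ⟨x₁, hx₁, x₂, hx₂, rfl, hm₁, hm₂⟩
    refine ⟨⟨add_le_add hx₁.1 hx₂.1, add_le_add hx₁.2 hx₂.2⟩, ?_⟩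
    have hlo : max l₁ (x₁ + x₂ - u₂) ≤ x₁ := max_le hx₁.1 (by linarith [hx₂.2])
    have hhi : x₁ ≤ min u₁ (x₁ + x₂ - l₂) := le_min hx₁.2 (by linarith [hx₂.1])
    obtain ⟨t, ht, hpt⟩ : ∃ t ∈ Set.Icc (0 : ℝ) 1, p (x₁ + x₂) t = x₁ := by
      have hcont : ContinuousOn (p (x₁ + x₂)) (Set.Icc 0 1) := by
        simp only [p]
        fun_prop
      have := intermediate_value_Icc (zero_le_one' ℝ) hcont
      refine this ⟨?_, ?_⟩
      · simpa [p] using hlo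
      · simpa [p] using hhi
    refine le_csSup_of_le (isCompact_Icc.image_of_continuousOn (hfx _)).bddAbove ⟨t, ht, rfl⟩ ?_
    have : x₁ + x₂ - x₁ = x₂ := by ring
    simp only [f, hpt, this, hE₁ _ hx₁, hE₂ _ hx₂]
    exact le_min hm₁ hm₂
  · rintro ⟨hx, hm⟩
    obtain ⟨t, ht, hsup⟩ := (isCompact_Icc.image_of_continuousOn (hfx x)).sSup_mem
      ((Set.nonempty_Icc.2 zero_le_one).image _)
    replace hm : m ≤ f x t := hm.trans_eq hsup.symm
    have hle : max l₁ (x - u₂) ≤ min u₁ (x - l₂) := by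
      refine max_le (le_min h₁ ?_) (le_min ?_ ?_) <;> linarith [hx.1, hx.2]
    have hplo : max l₁ (x - u₂) ≤ p x t := by
      simp only [p]
      nlinarith [ht.1, ht.2]
    have hphi : p x t ≤ min u₁ (x - l₂) := by
      simp only [p]
      nlinarith [ht.1, ht.2]
    have hp₁ : p x t ∈ Set.Icc l₁ u₁ :=
      ⟨(le_max_left _ _).trans hplo, hphi.trans (min_le_left _ _)⟩
    have hp₂ : x - p x t ∈ Set.Icc l₂ u₂ :=
      ⟨by linarith [hphi.trans (min_le_right _ _)], by linarith [(le_max_right _ _).trans hplo]⟩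
    have hm' := le_min_iff.1 hm
    rw [hE₁ _ hp₁, hE₂ _ hp₂] at hm'
    exact ⟨p x t, hp₁, x - p x t, hp₂, by ring, hm'.1, hm'.2⟩

/-- Mixing a splitting of `x` at level `m` with an optimal splitting of `z` splits the point between
them, and both summands then exceed `m` strictly. -/
theorem StrictQuasi.maxMin_convolution {I₁ I₂ I : Set ℝ} {g₁ g₂ G : ℝ → ℝ}
    (h₁ : StrictQuasi I₁ g₁) (h₂ : StrictQuasi I₂ g₂)
    (hG : ∀ x m, (∃ x₁ ∈ I₁, ∃ x₂ ∈ I₂, x₁ + x₂ = x ∧ m ≤ g₁ x₁ ∧ m ≤ g₂ x₂) ↔ x ∈ I ∧ m ≤ G x)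
    (hI₁ : Convex ℝ I₁) (hI₂ : Convex ℝ I₂) : StrictQuasi I G := by
  rintro x hx z hz y ⟨s, t, hs, ht, hst, rfl⟩ m hmx hmz
  obtain ⟨x₁, hx₁, x₂, hx₂, rfl, hxm₁, hxm₂⟩ := (hG x m).2 ⟨hx, hmx⟩
  obtain ⟨z₁, hz₁, z₂, hz₂, rfl, hzm₁, hzm₂⟩ := (hG z _).2 ⟨hz, le_rfl⟩
  have hy₁ := h₁ x₁ hx₁ z₁ hz₁ (s • x₁ + t • z₁) ⟨s, t, hs, ht, hst, rfl⟩ m hxm₁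
    (hmz.trans_le hzm₁)
  have hy₂ := h₂ x₂ hx₂ z₂ hz₂ (s • x₂ + t • z₂) ⟨s, t, hs, ht, hst, rfl⟩ m hxm₂
    (hmz.trans_le hzm₂)
  refine (lt_min hy₁ hy₂).trans_le ((hG _ _).1 ⟨s • x₁ + t • z₁, hI₁ hx₁ hz₁ hs.le ht.le hst,
    s • x₂ + t • z₂, hI₂ hx₂ hz₂ hs.le ht.le hst, ?_, min_le_left _ _, min_le_right _ _⟩).2
  simp only [smul_eq_mul]
  ring

/-! ### Tight points of a level -/

/-- `k` is the last point of `I` at which `g` reaches the level `y`. -/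
structure UpperTight (I : Set ℝ) (g : ℝ → ℝ) (y k : ℝ) : Prop where
  mem : k ∈ I
  le_apply : y ≤ g k
  lt_of_lt : ∀ x ∈ I, k < x → g x < y

/-- `k` is the first point of `I` at which `g` reaches the level `y`. -/
structure LowerTight (I : Set ℝ) (g : ℝ → ℝ) (y k : ℝ) : Prop where
  mem : k ∈ I
  le_apply : y ≤ g k
  lt_of_lt : ∀ x ∈ I, x < k → g x < y

theorem UpperTight.le {I : Set ℝ} {g : ℝ → ℝ} {y k y' k' : ℝ} (h : UpperTight I g y k)
    (h' : UpperTight I g y' k') (hy : y' ≤ y) : k ≤ k' := by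
  by_contra! hk
  linarith [h'.lt_of_lt k h.mem hk, h.le_apply]

theorem LowerTight.le {I : Set ℝ} {g : ℝ → ℝ} {y k y' k' : ℝ} (h : LowerTight I g y k)
    (h' : LowerTight I g y' k') (hy : y ≤ y') : k ≤ k' := by
  by_contra! hk
  linarith [h.lt_of_lt k' h'.mem hk, h'.le_apply]

/-- If `g k` exceeded the level, continuity would let points to the right of `k` reach it too. Only
at the end point `u` can the value stay above the level. -/
theorem UpperTight.apply_eq {l u : ℝ} {g : ℝ → ℝ} {y k : ℝ} (h : UpperTight (Set.Icc l u) g y k)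
    (hg : ContinuousOn g (Set.Icc l u)) (hk : k < u) : g k = y := by
  refine le_antisymm (le_of_not_gt fun hlt => ?_) h.le_apply
  have h1 : ∀ᶠ x in 𝓝[Set.Icc l u] k, y < g x := (hg k h.mem).eventually_const_lt hlt
  have hI : Set.Ioo k u ∈ 𝓝[>] k := Ioo_mem_nhdsGT hk
  have h2 : 𝓝[>] k ≤ 𝓝[Set.Icc l u] k := nhdsWithin_le_of_mem
    (Filter.mem_of_superset hI fun x hx => ⟨h.mem.1.trans hx.1.le, hx.2.le⟩)
  obtain ⟨x, hx, hxI⟩ := ((h1.filter_mono h2).and hI).exists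
  exact lt_asymm hx (h.lt_of_lt x ⟨h.mem.1.trans hxI.1.le, hxI.2.le⟩ hxI.1)

theorem LowerTight.apply_eq {l u : ℝ} {g : ℝ → ℝ} {y k : ℝ} (h : LowerTight (Set.Icc l u) g y k)
    (hg : ContinuousOn g (Set.Icc l u)) (hk : l < k) : g k = y := by
  refine le_antisymm (le_of_not_gt fun hlt => ?_) h.le_apply
  have h1 : ∀ᶠ x in 𝓝[Set.Icc l u] k, y < g x := (hg k h.mem).eventually_const_lt hlt
  have hI : Set.Ioo l k ∈ 𝓝[<] k := Ioo_mem_nhdsLT hk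
  have h2 : 𝓝[<] k ≤ 𝓝[Set.Icc l u] k := nhdsWithin_le_of_mem
    (Filter.mem_of_superset hI fun x hx => ⟨hx.1.le, hx.2.le.trans h.mem.2⟩)
  obtain ⟨x, hx, hxI⟩ := ((h1.filter_mono h2).and hI).exists
  exact lt_asymm hx (h.lt_of_lt x ⟨hxI.1.le, hxI.2.le.trans h.mem.2⟩ hxI.2)

/-! ### Capacity profiles -/

/-- Near `x`, the difference quotients of `g` at `x` are bounded away from zero. -/
def SteepAt (I : Set ℝ) (g : ℝ → ℝ) (x : ℝ) : Prop :=
  ∃ ε > 0, ∃ δ > 0, ∀ y ∈ I, |y - x| < δ → ε * |y - x| ≤ |g y - g x|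

/-- The qualitative part of the class `S₁`: `C x / x` increases on `[l, o]` and is constant on
`[o, a]`, while `C` is constant on `[a, b]` and decreases on `[b, u]`. -/
structure CapProfile (l o a b u : ℝ) (C : ℝ → ℝ) : Prop where
  l_pos : 0 < l
  le_o : l ≤ o
  o_le : o ≤ a
  a_le : a ≤ b
  b_le : b ≤ u
  continuousOn : ContinuousOn C (Set.Icc l u)
  pos : ∀ x ∈ Set.Icc l u, 0 < C x
  ratio_strictMonoOn : StrictMonoOn (fun x => C x / x) (Set.Icc l o)
  ratio_const_on : ∀ x ∈ Set.Icc o a, C x / x = C o / o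
  const_on : ∀ x ∈ Set.Icc a b, C x = C a
  strictAntiOn : StrictAntiOn C (Set.Icc b u)

namespace CapProfile

variable {l o a b u : ℝ} {C : ℝ → ℝ}

theorem l_le_u (h : CapProfile l o a b u C) : l ≤ u :=
  h.le_o.trans (h.o_le.trans (h.a_le.trans h.b_le))

theorem pos_of_mem (h : CapProfile l o a b u C) {x : ℝ} (hx : x ∈ Set.Icc l u) : 0 < x :=
  h.l_pos.trans_le hx.1

theorem a_mem (h : CapProfile l o a b u C) : a ∈ Set.Icc l u :=
  ⟨h.le_o.trans h.o_le, h.a_le.trans h.b_le⟩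

theorem o_mem (h : CapProfile l o a b u C) : o ∈ Set.Icc l u :=
  ⟨h.le_o, h.o_le.trans h.a_mem.2⟩

theorem ratio_continuousOn (h : CapProfile l o a b u C) :
    ContinuousOn (fun x => C x / x) (Set.Icc l u) :=
  h.continuousOn.div continuousOn_id fun _ hx => (h.pos_of_mem hx).ne'

theorem ratio_pos (h : CapProfile l o a b u C) {x : ℝ} (hx : x ∈ Set.Icc l u) : 0 < C x / x :=
  div_pos (h.pos x hx) (h.pos_of_mem hx)

/-- Beyond `a` the numerator no longer increases while the denominator does, so the plateau of the
ratio ends at `a`. -/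
theorem ratio_isS0With (h : CapProfile l o a b u C) : IsS0With l u (fun x => C x / x) o a := by
  refine ⟨h.ratio_continuousOn, h.o_mem, ⟨h.o_le, h.a_mem.2⟩, h.ratio_strictMonoOn,
    h.ratio_const_on, ?_⟩
  intro x hx y hy hxy
  have hx0 : 0 < x := h.l_pos.trans_le (h.a_mem.1.trans hx.1)
  have hxI : x ∈ Set.Icc l u := ⟨h.a_mem.1.trans hx.1, hx.2⟩
  have hle : C y ≤ C x := by
    rcases le_total b x with hbx | hxb
    · exact h.strictAntiOn.antitoneOn ⟨hbx, hx.2⟩ ⟨hbx.trans hxy.le, hy.2⟩ hxy.le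
    · rw [h.const_on x ⟨hx.1, hxb⟩]
      rcases le_total b y with hby | hyb
      · rw [← h.const_on b ⟨h.a_le, le_rfl⟩]
        exact h.strictAntiOn.antitoneOn ⟨le_rfl, h.b_le⟩ ⟨hby, hy.2⟩ hby
      · exact (h.const_on y ⟨hy.1, hyb⟩).le
  exact div_lt_div₀' hle hxy (h.pos x hxI) hx0

theorem ratio_a (h : CapProfile l o a b u C) : C a / a = C o / o :=
  h.ratio_const_on a ⟨h.o_le, le_rfl⟩

theorem ratio_le (h : CapProfile l o a b u C) {x : ℝ} (hx : x ∈ Set.Icc l u) :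
    C x / x ≤ C a / a := by
  rw [h.ratio_a]
  exact h.ratio_isS0With.le_apply_fst hx

theorem ratio_monotoneOn (h : CapProfile l o a b u C) :
    MonotoneOn (fun x => C x / x) (Set.Icc l a) := by
  intro x hx y hy hxy
  rcases le_total y o with hyo | hyo
  · exact h.ratio_strictMonoOn.monotoneOn ⟨hx.1, hxy.trans hyo⟩ ⟨hy.1, hyo⟩ hxy
  · change C x / x ≤ C y / y
    rw [h.ratio_const_on y ⟨hyo, hy.2⟩, ← h.ratio_a]
    exact h.ratio_le ⟨hx.1, hx.2.trans h.a_mem.2⟩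

theorem isS0With (h : CapProfile l o a b u C) : IsS0With l u C a b := by
  refine ⟨h.continuousOn, h.a_mem, ⟨h.a_le, h.b_le⟩, ?_, h.const_on, h.strictAntiOn⟩
  intro x hx y hy hxy
  have hx0 : 0 < x := h.l_pos.trans_le hx.1
  have hy0 : 0 < y := hx0.trans hxy
  have h1 : C x / x ≤ C y / y := h.ratio_monotoneOn hx hy hxy.le
  have h2 := h.pos x ⟨hx.1, hx.2.trans h.a_mem.2⟩
  rw [div_le_div_iff₀ hx0 hy0] at h1
  nlinarith

theorem le_apply_a (h : CapProfile l o a b u C) {x : ℝ} (hx : x ∈ Set.Icc l u) : C x ≤ C a :=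
  h.isS0With.le_apply_fst hx

theorem antitoneOn (h : CapProfile l o a b u C) : AntitoneOn C (Set.Icc a u) :=
  h.isS0With.antitoneOn

section Tight

variable {y k y' k' : ℝ}

theorem mul_le_of_le_ratio (h : CapProfile l o a b u C) (hk : k ∈ Set.Icc l u)
    (hy : y ≤ C k / k) : y * k ≤ C k :=
  (le_div_iff₀ (h.pos_of_mem hk)).1 hy

theorem a_le_of_upperTight (h : CapProfile l o a b u C)
    (ht : UpperTight (Set.Icc l u) (fun x => C x / x) y k) : a ≤ k := by
  by_contra! hk
  have h1 := ht.lt_of_lt a h.a_mem hk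
  have h2 := ht.le_apply
  have h3 := h.ratio_le ht.mem
  linarith

/-- Here `y * k` is the flow at level `y`. At the higher level the flow equals `C k` unless `k = u`,
while at the lower one it is at most `C k'`; and `k = u` forces `k' = u`. -/
theorem sub_le_of_upperTight (h : CapProfile l o a b u C)
    (ht : UpperTight (Set.Icc l u) (fun x => C x / x) y k)
    (ht' : UpperTight (Set.Icc l u) (fun x => C x / x) y' k') (hy : y' ≤ y) :
    0 ≤ C k - C k' ∧ C k - C k' ≤ y * k - y' * k' := by
  have hkk := ht.le ht' hy
  have hC : C k' ≤ C k := h.antitoneOn ⟨h.a_le_of_upperTight ht, ht.mem.2⟩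
    ⟨h.a_le_of_upperTight ht', ht'.mem.2⟩ hkk
  refine ⟨sub_nonneg.2 hC, ?_⟩
  rcases ht.mem.2.eq_or_lt with rfl | hku
  · obtain rfl : k' = k := le_antisymm ht'.mem.2 hkk
    nlinarith [h.pos_of_mem ht.mem]
  · have h1 : C k / k = y := ht.apply_eq h.ratio_continuousOn hku
    have h2 : C k = y * k := (div_eq_iff (h.pos_of_mem ht.mem).ne').1 h1
    linarith [h.mul_le_of_le_ratio ht'.mem ht'.le_apply]

theorem abs_sub_le_of_upperTight (h : CapProfile l o a b u C)
    (ht : UpperTight (Set.Icc l u) (fun x => C x / x) y k)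
    (ht' : UpperTight (Set.Icc l u) (fun x => C x / x) y' k') :
    |C k' - C k| ≤ |y' * k' - y * k| := by
  rcases le_total y' y with hy | hy
  · obtain ⟨h1, h2⟩ := h.sub_le_of_upperTight ht ht' hy
    rw [abs_sub_comm, abs_of_nonneg h1, abs_sub_comm]
    exact h2.trans (le_abs_self _)
  · obtain ⟨h1, h2⟩ := h.sub_le_of_upperTight ht' ht hy
    rw [abs_of_nonneg h1]
    exact h2.trans (le_abs_self _)

/-- An unsaturated flow moves at least linearly with the level. If `k ≤ b`, then `C k / k` lies
strictly above `y`, so `k = u`, nearby levels share this tight point, and the flow is linear in the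
level. If `k > b`, steepness of `C` bounds `k' - k` by the change of flow. -/
theorem exists_steep_of_upperTight (h : CapProfile l o a b u C)
    (hq : ∀ x ∈ Set.Ioc b u, SteepAt (Set.Icc l u) C x)
    (ht : UpperTight (Set.Icc l u) (fun x => C x / x) y k) (hy : y * k ≠ C a) :
    ∃ ε > 0, ∃ δ > 0, ∀ y' k', 0 < y' → UpperTight (Set.Icc l u) (fun x => C x / x) y' k' →
      |y' - y| < δ → |k' - k| < δ → ε * |y' - y| ≤ |y' * k' - y * k| := by
  have hk0 : 0 < k := h.pos_of_mem ht.mem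
  have hak := h.a_le_of_upperTight ht
  rcases le_or_gt k b with hkb | hbk
  · have hCk : C k = C a := h.const_on k ⟨hak, hkb⟩
    have hlt : y < C k / k := by
      refine lt_of_le_of_ne ht.le_apply fun he => hy ?_
      rw [he, ← hCk]
      field_simp
    have hku : k = u := by
      by_contra hne
      exact hlt.ne' (ht.apply_eq h.ratio_continuousOn (lt_of_le_of_ne ht.mem.2 hne))
    refine ⟨k, hk0, C k / k - y, sub_pos.2 hlt, fun y' k' _ ht' hy' _ => ?_⟩
    have hk' : k' = k := by
      refine le_antisymm (hku ▸ ht'.mem.2) (le_of_not_gt fun hkk => ?_)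
      have := ht'.lt_of_lt k ht.mem hkk
      linarith [(abs_lt.1 hy').2]
    rw [hk', ← sub_mul, abs_mul, abs_of_pos hk0, mul_comm]
  · obtain ⟨ε, hε, δ, hδ, hst⟩ := hq k ⟨hbk, ht.mem.2⟩
    set Y := C a / a with hY
    have hY0 : 0 < Y := h.ratio_pos h.a_mem
    -- From `k * |y' - y| ≤ |Δ| + Y * |k' - k|` and `ε * |k' - k| ≤ |Δ|`, where `Δ` is the change of
    -- flow.
    refine ⟨k * ε / (ε + Y), by positivity, δ, hδ, fun y' k' hy0 ht' _ hk' => ?_⟩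
    have h1 := (hst k' ht'.mem hk').trans (h.abs_sub_le_of_upperTight ht ht')
    have h2 : y' ≤ Y := ht'.le_apply.trans (h.ratio_le ht'.mem)
    have h3 : |y' - y| * k ≤ |y' * k' - y * k| + y' * |k' - k| := by
      calc |y' - y| * k = |(y' * k' - y * k) - y' * (k' - k)| := by
            rw [← abs_of_pos hk0, ← abs_mul, abs_of_pos hk0]
            ring_nf
        _ ≤ |y' * k' - y * k| + |y' * (k' - k)| := abs_sub _ _
        _ = _ := by rw [abs_mul, abs_of_pos hy0]
    have h4 : y' * |k' - k| ≤ Y * |k' - k| := by gcongr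
    rw [div_mul_eq_mul_div, div_le_iff₀ (by positivity)]
    nlinarith [abs_nonneg (y' * k' - y * k), mul_le_mul_of_nonneg_left h1 hY0.le,
      mul_le_mul_of_nonneg_left h3 hε.le, mul_le_mul_of_nonneg_left h4 hε.le]

theorem le_o_of_lowerTight (h : CapProfile l o a b u C)
    (ht : LowerTight (Set.Icc l u) (fun x => C x / x) y k) (hy : y ≤ C o / o) : k ≤ o := by
  by_contra! hk
  exact absurd (ht.lt_of_lt o h.o_mem hk) (not_lt.2 hy)

theorem ratio_sub_le_of_lowerTight (h : CapProfile l o a b u C)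
    (ht : LowerTight (Set.Icc l u) (fun x => C x / x) y k)
    (ht' : LowerTight (Set.Icc l u) (fun x => C x / x) y' k') (hy : y ≤ y')
    (hy' : y' ≤ C o / o) :
    0 ≤ C k' / k' - C k / k ∧ C k' / k' - C k / k ≤ y' - y := by
  have hkk := ht.le ht' hy
  have hk' := h.le_o_of_lowerTight ht' hy'
  have hg : C k / k ≤ C k' / k' :=
    h.ratio_strictMonoOn.monotoneOn ⟨ht.mem.1, hkk.trans hk'⟩ ⟨ht'.mem.1, hk'⟩ hkk
  refine ⟨sub_nonneg.2 hg, ?_⟩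
  rcases hkk.eq_or_lt with rfl | hlt
  · simpa using hy
  · have h1 : C k' / k' = y' := ht'.apply_eq h.ratio_continuousOn (ht.mem.1.trans_lt hlt)
    have h2 : y ≤ C k / k := ht.le_apply
    linarith

/-- Steepness of the ratio before `o` bounds the motion of the tight point by that of the level.
Below the top level, `k = o` occurs only if `o = l`, and then all these tight points coincide. -/
theorem exists_steep_of_lowerTight (h : CapProfile l o a b u C)
    (hq : ∀ x ∈ Set.Ico l o, SteepAt (Set.Icc l u) (fun x => C x / x) x)
    (ht : LowerTight (Set.Icc l u) (fun x => C x / x) y k) (hy : y < C o / o) :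
    ∃ ε > 0, ∃ δ > 0, ∀ y' k', y' < C o / o →
      LowerTight (Set.Icc l u) (fun x => C x / x) y' k' →
      |k' - k| < δ → ε * |k' - k| ≤ |y' - y| := by
  rcases (h.le_o_of_lowerTight ht hy.le).eq_or_lt with rfl | hko
  · have hkl : k = l := by
      by_contra hne
      exact hy.ne' (ht.apply_eq h.ratio_continuousOn (lt_of_le_of_ne ht.mem.1 (Ne.symm hne)))
    refine ⟨1, one_pos, 1, one_pos, fun y' k' hy' ht' _ => ?_⟩
    have : k' = k := le_antisymm (h.le_o_of_lowerTight ht' hy'.le) (hkl ▸ ht'.mem.1)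
    simp [this]
  · obtain ⟨ε, hε, δ, hδ, hst⟩ := hq k ⟨ht.mem.1, hko⟩
    refine ⟨ε, hε, δ, hδ, fun y' k' hy' ht' hk' => (hst k' ht'.mem hk').trans ?_⟩
    rcases le_total y y' with hyy | hyy
    · obtain ⟨h1, h2⟩ := h.ratio_sub_le_of_lowerTight ht ht' hyy hy'.le
      rw [abs_of_nonneg h1]
      exact h2.trans (le_abs_self _)
    · obtain ⟨h1, h2⟩ := h.ratio_sub_le_of_lowerTight ht' ht hyy hy.le
      rw [abs_sub_comm, abs_of_nonneg h1, abs_sub_comm]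
      exact h2.trans (le_abs_self _)

end Tight

end CapProfile

/-! ### Parallel composition as a max-min convolution of ratios -/

theorem CapProfile.mul_eq_of_upperTight {l o a b u y k y' k' : ℝ} {C : ℝ → ℝ}
    (h : CapProfile l o a b u C)
    (ht : UpperTight (Set.Icc l u) (fun x => C x / x) y k)
    (ht' : UpperTight (Set.Icc l u) (fun x => C x / x) y' k') (hy0 : 0 < y') (hy : y' < y)
    (he : y * k = y' * k') : y * k = C a := by
  have hk0 := h.pos_of_mem ht.mem
  -- An unchanged flow at a lower level needs a larger weight.
  have hkk : k < k' := by
    by_contra! hle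
    have := mul_le_mul_of_nonneg_left hle hy0.le
    nlinarith
  have hak := h.a_le_of_upperTight ht
  have hC : C k = C k' := by
    obtain ⟨h1, h2⟩ := h.sub_le_of_upperTight ht ht' hy.le
    linarith
  -- `C` agrees at the distinct points `k` and `k'`, so `k` lies on the plateau of `C` and the flow
  -- is saturated.
  have hkb : k ≤ b := by
    by_contra! hbk
    exact hC.not_gt (h.strictAntiOn ⟨hbk.le, ht.mem.2⟩ ⟨hbk.le.trans hkk.le, ht'.mem.2⟩ hkk)
  have h1 : C k / k = y := ht.apply_eq h.ratio_continuousOn (hkk.trans_le ht'.mem.2)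
  rw [← (div_eq_iff hk0.ne').1 h1, h.const_on k ⟨hak, hkb⟩]

/-- The hypothesis `hf` excludes plateaus below the initial value, so `b` is the last point at which
that value is attained. -/
theorem exists_const_strictAnti {a u : ℝ} {f : ℝ → ℝ} (hau : a ≤ u)
    (hc : ContinuousOn f (Set.Icc a u)) (ha : AntitoneOn f (Set.Icc a u))
    (hf : ∀ x ∈ Set.Icc a u, ∀ x' ∈ Set.Icc a u, x < x' → f x = f x' → f x = f a) :
    ∃ b ∈ Set.Icc a u, (∀ x ∈ Set.Icc a b, f x = f a) ∧ StrictAntiOn f (Set.Icc b u) := by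
  have hAc : IsCompact (Set.Icc a u ∩ f ⁻¹' {f a}) :=
    isCompact_Icc.of_isClosed_subset (hc.preimage_isClosed_of_isClosed isClosed_Icc
      isClosed_singleton) Set.inter_subset_left
  obtain ⟨b, ⟨hbI, hbf⟩, hb⟩ := hAc.exists_isGreatest ⟨a, ⟨le_rfl, hau⟩, rfl⟩
  have hbf : f b = f a := hbf
  refine ⟨b, hbI, fun x hx => ?_, fun x hx x' hx' hxx => ?_⟩
  · have hxI : x ∈ Set.Icc a u := ⟨hx.1, hx.2.trans hbI.2⟩
    exact le_antisymm (ha ⟨le_rfl, hau⟩ hxI hx.1) (hbf ▸ ha hxI hbI hx.2)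
  · have hxI : x ∈ Set.Icc a u := ⟨hbI.1.trans hx.1, hx.2⟩
    have hxI' : x' ∈ Set.Icc a u := ⟨hbI.1.trans hx'.1, hx'.2⟩
    refine lt_of_le_of_ne (ha hxI hxI' hxx.le) fun he => ?_
    have h1 := hf x hxI x' hxI' hxx he.symm
    exact absurd (hb ⟨hxI', he.trans h1⟩) (not_le.2 (hx.1.trans_lt hxx))

/-- `G` is the max-min convolution of `g₁` on `I₁` and `g₂` on `I₂`. -/
def IsMaxMin (I₁ I₂ I : Set ℝ) (g₁ g₂ G : ℝ → ℝ) : Prop :=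
  ∀ x m, (∃ x₁ ∈ I₁, ∃ x₂ ∈ I₂, x₁ + x₂ = x ∧ m ≤ g₁ x₁ ∧ m ≤ g₂ x₂) ↔ x ∈ I ∧ m ≤ G x

namespace IsMaxMin

variable {l₁ u₁ l₂ u₂ o a x : ℝ} {g₁ g₂ G : ℝ → ℝ}

/-- Where `G` strictly decreases, neither summand of an optimal splitting can move right at the same
level: this would reach `G x` at a larger total. -/
theorem exists_upperTight
    (hG : IsMaxMin (Set.Icc l₁ u₁) (Set.Icc l₂ u₂) (Set.Icc (l₁ + l₂) (u₁ + u₂)) g₁ g₂ G)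
    (hS : IsS0With (l₁ + l₂) (u₁ + u₂) G o a) (hx : x ∈ Set.Icc a (u₁ + u₂)) :
    ∃ x₁ x₂, x₁ + x₂ = x ∧ UpperTight (Set.Icc l₁ u₁) g₁ (G x) x₁ ∧
      UpperTight (Set.Icc l₂ u₂) g₂ (G x) x₂ := by
  obtain ⟨x₁, hx₁, x₂, hx₂, rfl, hm₁, hm₂⟩ := (hG x (G x)).2
    ⟨⟨hS.fst_mem.1.trans (hS.snd_mem.1.trans hx.1), hx.2⟩, le_rfl⟩
  have key : ∀ y ∈ Set.Icc (l₁ + l₂) (u₁ + u₂), x₁ + x₂ < y → ¬ G (x₁ + x₂) ≤ G y :=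
    fun y hy hxy => not_le.2 (hS.strictAntiOn hx ⟨hx.1.trans hxy.le, hy.2⟩ hxy)
  refine ⟨x₁, x₂, rfl, ⟨hx₁, hm₁, fun k hk hlt => ?_⟩, ⟨hx₂, hm₂, fun k hk hlt => ?_⟩⟩
  · by_contra! hle
    obtain ⟨h1, h2⟩ := (hG (k + x₂) _).1 ⟨k, hk, x₂, hx₂, rfl, hle, hm₂⟩
    exact key _ h1 (by linarith) h2
  · by_contra! hle
    obtain ⟨h1, h2⟩ := (hG (x₁ + k) _).1 ⟨x₁, hx₁, k, hk, rfl, hm₁, hle⟩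
    exact key _ h1 (by linarith) h2

theorem exists_lowerTight
    (hG : IsMaxMin (Set.Icc l₁ u₁) (Set.Icc l₂ u₂) (Set.Icc (l₁ + l₂) (u₁ + u₂)) g₁ g₂ G)
    (hS : IsS0With (l₁ + l₂) (u₁ + u₂) G o a) (hx : x ∈ Set.Icc (l₁ + l₂) o) :
    ∃ x₁ x₂, x₁ + x₂ = x ∧ LowerTight (Set.Icc l₁ u₁) g₁ (G x) x₁ ∧
      LowerTight (Set.Icc l₂ u₂) g₂ (G x) x₂ := by
  obtain ⟨x₁, hx₁, x₂, hx₂, rfl, hm₁, hm₂⟩ := (hG x (G x)).2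
    ⟨⟨hx.1, hx.2.trans hS.fst_mem.2⟩, le_rfl⟩
  have key : ∀ y ∈ Set.Icc (l₁ + l₂) (u₁ + u₂), y < x₁ + x₂ → ¬ G (x₁ + x₂) ≤ G y :=
    fun y hy hxy => not_le.2 (hS.strictMonoOn ⟨hy.1, hxy.le.trans hx.2⟩ hx hxy)
  refine ⟨x₁, x₂, rfl, ⟨hx₁, hm₁, fun k hk hlt => ?_⟩, ⟨hx₂, hm₂, fun k hk hlt => ?_⟩⟩
  · by_contra! hle
    obtain ⟨h1, h2⟩ := (hG (k + x₂) _).1 ⟨k, hk, x₂, hx₂, rfl, hle, hm₂⟩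
    exact key _ h1 (by linarith) h2
  · by_contra! hle
    obtain ⟨h1, h2⟩ := (hG (x₁ + k) _).1 ⟨x₁, hx₁, k, hk, rfl, hm₁, hle⟩
    exact key _ h1 (by linarith) h2

end IsMaxMin

/-- Each tight summand moves by at most a constant times the change of level, hence so does their
sum `x`. -/
theorem steepAt_of_lowerTight {l₁ o₁ a₁ b₁ u₁ l₂ o₂ a₂ b₂ u₂ o a x : ℝ} {C₁ C₂ G : ℝ → ℝ}
    (h₁ : CapProfile l₁ o₁ a₁ b₁ u₁ C₁) (h₂ : CapProfile l₂ o₂ a₂ b₂ u₂ C₂)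
    (hG : IsMaxMin (Set.Icc l₁ u₁) (Set.Icc l₂ u₂) (Set.Icc (l₁ + l₂) (u₁ + u₂))
      (fun x => C₁ x / x) (fun x => C₂ x / x) G)
    (hS : IsS0With (l₁ + l₂) (u₁ + u₂) G o a)
    (hq₁ : ∀ x ∈ Set.Ico l₁ o₁, SteepAt (Set.Icc l₁ u₁) (fun x => C₁ x / x) x)
    (hq₂ : ∀ x ∈ Set.Ico l₂ o₂, SteepAt (Set.Icc l₂ u₂) (fun x => C₂ x / x) x)
    (hx : x ∈ Set.Ico (l₁ + l₂) o) : SteepAt (Set.Icc (l₁ + l₂) (u₁ + u₂)) G x := by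
  -- An optimal splitting of `o` shows that levels before `o` lie strictly below the maxima of both
  -- ratios.
  obtain ⟨p₁, hp₁, p₂, hp₂, hpo, hpm₁, hpm₂⟩ := (hG o (G o)).2 ⟨hS.fst_mem, le_rfl⟩
  have hGo : ∀ y ∈ Set.Ico (l₁ + l₂) o, G y < C₁ o₁ / o₁ ∧ G y < C₂ o₂ / o₂ := by
    intro y hy
    have h3 := hS.strictMonoOn ⟨hy.1, hy.2.le⟩ ⟨hS.fst_mem.1, le_rfl⟩ hy.2
    exact ⟨h3.trans_le (hpm₁.trans ((h₁.ratio_le hp₁).trans_eq h₁.ratio_a)),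
      h3.trans_le (hpm₂.trans ((h₂.ratio_le hp₂).trans_eq h₂.ratio_a))⟩
  obtain ⟨x₁, x₂, hxx, ht₁, ht₂⟩ := hG.exists_lowerTight hS (Set.Ico_subset_Icc_self hx)
  obtain ⟨ε₁, hε₁, δ₁, hδ₁, e₁⟩ := h₁.exists_steep_of_lowerTight hq₁ ht₁ (hGo x hx).1
  obtain ⟨ε₂, hε₂, δ₂, hδ₂, e₂⟩ := h₂.exists_steep_of_lowerTight hq₂ ht₂ (hGo x hx).2
  refine ⟨min ε₁ ε₂ / 2, by positivity, min (min δ₁ δ₂) (o - x),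
    lt_min (lt_min hδ₁ hδ₂) (sub_pos.2 hx.2), fun x' hx' hlt => ?_⟩
  obtain ⟨hlt, hlto⟩ := lt_min_iff.1 hlt
  obtain ⟨hlt₁, hlt₂⟩ := lt_min_iff.1 hlt
  have hxo : x' ∈ Set.Ico (l₁ + l₂) o := ⟨hx'.1, by linarith [(abs_lt.1 hlto).2]⟩
  obtain ⟨x₁', x₂', hxx', ht₁', ht₂'⟩ := hG.exists_lowerTight hS (Set.Ico_subset_Icc_self hxo)
  have hsum : x' - x = (x₁' - x₁) + (x₂' - x₂) := by rw [← hxx, ← hxx']; ring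
  -- The summands move in the same direction, so neither moves farther than `x` does, and each stays
  -- in the range of its own steepness bound.
  have hcomon : |x₁' - x₁| ≤ |x' - x| ∧ |x₂' - x₂| ≤ |x' - x| := by
    rcases le_total (G x) (G x') with hle | hle
    · have k₁ := sub_nonneg.2 (ht₁.le ht₁' hle)
      have k₂ := sub_nonneg.2 (ht₂.le ht₂' hle)
      rw [abs_of_nonneg k₁, abs_of_nonneg k₂]
      constructor <;> exact le_trans (by linarith) (le_abs_self _)
    · have k₁ := sub_nonpos.2 (ht₁'.le ht₁ hle)
      have k₂ := sub_nonpos.2 (ht₂'.le ht₂ hle)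
      rw [abs_of_nonpos k₁, abs_of_nonpos k₂]
      constructor <;> exact le_trans (by linarith) (neg_le_abs _)
  have f₁ := e₁ _ _ (hGo x' hxo).1 ht₁' (hcomon.1.trans_lt hlt₁)
  have f₂ := e₂ _ _ (hGo x' hxo).2 ht₂' (hcomon.2.trans_lt hlt₂)
  have f₁' : min ε₁ ε₂ * |x₁' - x₁| ≤ |G x' - G x| :=
    (mul_le_mul_of_nonneg_right (min_le_left _ _) (abs_nonneg _)).trans f₁
  have f₂' : min ε₁ ε₂ * |x₂' - x₂| ≤ |G x' - G x| :=
    (mul_le_mul_of_nonneg_right (min_le_right _ _) (abs_nonneg _)).trans f₂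
  have hmin : 0 < min ε₁ ε₂ := lt_min hε₁ hε₂
  have htri : |x' - x| ≤ |x₁' - x₁| + |x₂' - x₂| := hsum ▸ abs_add_le _ _
  nlinarith [mul_le_mul_of_nonneg_left htri hmin.le]

section UpperPart

variable {l₁ o₁ a₁ b₁ u₁ l₂ o₂ a₂ b₂ u₂ o a x x' : ℝ} {C₁ C₂ G : ℝ → ℝ}

/-- `x * G x` is the sum of the link flows `G x * xᵢ`, and neither grows as the level falls. Equal
totals mean that both flows are unchanged, which requires both to be saturated. -/
theorem mul_sub_mul_of_upperTight (h₁ : CapProfile l₁ o₁ a₁ b₁ u₁ C₁)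
    (h₂ : CapProfile l₂ o₂ a₂ b₂ u₂ C₂)
    (hG : IsMaxMin (Set.Icc l₁ u₁) (Set.Icc l₂ u₂) (Set.Icc (l₁ + l₂) (u₁ + u₂))
      (fun x => C₁ x / x) (fun x => C₂ x / x) G)
    (hS : IsS0With (l₁ + l₂) (u₁ + u₂) G o a) (hpos : ∀ x ∈ Set.Icc (l₁ + l₂) (u₁ + u₂), 0 < G x)
    (hx : x ∈ Set.Icc a (u₁ + u₂)) (hx' : x' ∈ Set.Icc a (u₁ + u₂)) (hxx : x < x') :
    x' * G x' ≤ x * G x ∧ (x * G x = x' * G x' → x * G x = C₁ a₁ + C₂ a₂) := by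
  obtain ⟨x₁, x₂, rfl, ht₁, ht₂⟩ := hG.exists_upperTight hS hx
  obtain ⟨x₁', x₂', rfl, ht₁', ht₂'⟩ := hG.exists_upperTight hS hx'
  have hlt := hS.strictAntiOn hx hx' hxx
  have hpos' := hpos _ ⟨hS.fst_mem.1.trans (hS.snd_mem.1.trans hx'.1), hx'.2⟩
  obtain ⟨p₁, q₁⟩ := h₁.sub_le_of_upperTight ht₁ ht₁' hlt.le
  obtain ⟨p₂, q₂⟩ := h₂.sub_le_of_upperTight ht₂ ht₂' hlt.le
  refine ⟨by linarith, fun he => ?_⟩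
  have r₁ := h₁.mul_eq_of_upperTight ht₁ ht₁' hpos' hlt (by linarith)
  have r₂ := h₂.mul_eq_of_upperTight ht₂ ht₂' hpos' hlt (by linarith)
  linarith

/-- Some link is unsaturated at `x`, so its flow moves at least linearly with the level. The other
flow moves in the same direction, so nothing cancels, and the level itself moves at least linearly
with `x`. -/
theorem steepAt_of_upperTight (h₁ : CapProfile l₁ o₁ a₁ b₁ u₁ C₁)
    (h₂ : CapProfile l₂ o₂ a₂ b₂ u₂ C₂)
    (hG : IsMaxMin (Set.Icc l₁ u₁) (Set.Icc l₂ u₂) (Set.Icc (l₁ + l₂) (u₁ + u₂))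
      (fun x => C₁ x / x) (fun x => C₂ x / x) G) (hGc : Continuous G)
    (hS : IsS0With (l₁ + l₂) (u₁ + u₂) G o a) (hpos : ∀ x ∈ Set.Icc (l₁ + l₂) (u₁ + u₂), 0 < G x)
    (hq₁ : ∀ x ∈ Set.Ioc b₁ u₁, SteepAt (Set.Icc l₁ u₁) C₁ x)
    (hq₂ : ∀ x ∈ Set.Ioc b₂ u₂, SteepAt (Set.Icc l₂ u₂) C₂ x)
    (hx : x ∈ Set.Ioc a (u₁ + u₂)) (hne : x * G x ≠ C₁ a₁ + C₂ a₂) :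
    SteepAt (Set.Icc (l₁ + l₂) (u₁ + u₂)) (fun x => x * G x) x := by
  obtain ⟨x₁, x₂, hxx, ht₁, ht₂⟩ := hG.exists_upperTight hS (Set.Ioc_subset_Icc_self hx)
  have hcomon : ∀ x' x₁' x₂', x₁' + x₂' = x' →
      UpperTight (Set.Icc l₁ u₁) (fun x => C₁ x / x) (G x') x₁' →
      UpperTight (Set.Icc l₂ u₂) (fun x => C₂ x / x) (G x') x₂' →
      |x₁' - x₁| ≤ |x' - x| ∧ |x₂' - x₂| ≤ |x' - x| ∧
      |G x' * x₁' - G x * x₁| ≤ |x' * G x' - x * G x| ∧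
      |G x' * x₂' - G x * x₂| ≤ |x' * G x' - x * G x| := by
    rintro x' x₁' x₂' rfl ht₁' ht₂'
    have e1 : (x₁' + x₂') * G (x₁' + x₂') - x * G x =
      (G (x₁' + x₂') * x₁' - G x * x₁) + (G (x₁' + x₂') * x₂' - G x * x₂) := by
      linear_combination G x * hxx
    have e2 : x₁' + x₂' - x = (x₁' - x₁) + (x₂' - x₂) := by rw [← hxx]; ring
    rw [e1, e2]
    rcases le_total (G (x₁' + x₂')) (G x) with hle | hle
    · have k₁ := sub_nonneg.2 (ht₁.le ht₁' hle)
      have k₂ := sub_nonneg.2 (ht₂.le ht₂' hle)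
      obtain ⟨p₁, q₁⟩ := h₁.sub_le_of_upperTight ht₁ ht₁' hle
      obtain ⟨p₂, q₂⟩ := h₂.sub_le_of_upperTight ht₂ ht₂' hle
      rw [abs_of_nonneg k₁, abs_of_nonneg k₂, abs_of_nonneg (add_nonneg k₁ k₂),
        abs_of_nonpos (by linarith : G (x₁' + x₂') * x₁' - G x * x₁ ≤ 0),
        abs_of_nonpos (by linarith : G (x₁' + x₂') * x₂' - G x * x₂ ≤ 0),
        abs_of_nonpos (by linarith)]
      refine ⟨?_, ?_, ?_, ?_⟩ <;> linarith
    · have k₁ := sub_nonpos.2 (ht₁'.le ht₁ hle)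
      have k₂ := sub_nonpos.2 (ht₂'.le ht₂ hle)
      obtain ⟨p₁, q₁⟩ := h₁.sub_le_of_upperTight ht₁' ht₁ hle
      obtain ⟨p₂, q₂⟩ := h₂.sub_le_of_upperTight ht₂' ht₂ hle
      rw [abs_of_nonpos k₁, abs_of_nonpos k₂, abs_of_nonpos (add_nonpos k₁ k₂),
        abs_of_nonneg (by linarith : 0 ≤ G (x₁' + x₂') * x₁' - G x * x₁),
        abs_of_nonneg (by linarith : 0 ≤ G (x₁' + x₂') * x₂' - G x * x₂),
        abs_of_nonneg (by linarith)]
      refine ⟨?_, ?_, ?_, ?_⟩ <;> linarith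
  have hI : ∀ y, y ∈ Set.Icc a (u₁ + u₂) → y ∈ Set.Icc (l₁ + l₂) (u₁ + u₂) := fun y hy =>
    ⟨hS.fst_mem.1.trans (hS.snd_mem.1.trans hy.1), hy.2⟩
  have key : ∃ ε > 0, ∃ δ > 0, ∀ x' ∈ Set.Icc a (u₁ + u₂), |x' - x| < δ → |G x' - G x| < δ →
      ε * |G x' - G x| ≤ |x' * G x' - x * G x| := by
    have hor : G x * x₁ ≠ C₁ a₁ ∨ G x * x₂ ≠ C₂ a₂ := by
      by_contra! hcon
      exact hne (by rw [← hcon.1, ← hcon.2, ← hxx]; ring)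
    rcases hor with hor | hor
    · obtain ⟨ε, hε, δ, hδ, e⟩ := h₁.exists_steep_of_upperTight hq₁ ht₁ hor
      refine ⟨ε, hε, δ, hδ, fun x' hx' hd hd' => ?_⟩
      obtain ⟨x₁', x₂', hxx', ht₁', ht₂'⟩ := hG.exists_upperTight hS hx'
      obtain ⟨c1, -, c3, -⟩ := hcomon x' x₁' x₂' hxx' ht₁' ht₂'
      exact (e _ _ (hpos x' (hI x' hx')) ht₁' hd' (c1.trans_lt hd)).trans c3
    · obtain ⟨ε, hε, δ, hδ, e⟩ := h₂.exists_steep_of_upperTight hq₂ ht₂ hor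
      refine ⟨ε, hε, δ, hδ, fun x' hx' hd hd' => ?_⟩
      obtain ⟨x₁', x₂', hxx', ht₁', ht₂'⟩ := hG.exists_upperTight hS hx'
      obtain ⟨-, c2, -, c4⟩ := hcomon x' x₁' x₂' hxx' ht₁' ht₂'
      exact (e _ _ (hpos x' (hI x' hx')) ht₂' hd' (c2.trans_lt hd)).trans c4
  obtain ⟨ε, hε, δ, hδ, e⟩ := key
  have hxI := Set.Ioc_subset_Icc_self hx
  have hGx := hpos x (hI x hxI)
  have hx0 : 0 < x := (add_pos h₁.l_pos h₂.l_pos).trans_le (hI x hxI).1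
  have hu0 : 0 < u₁ + u₂ := hx0.trans_le hx.2
  obtain ⟨δ', hδ', hcont⟩ := Metric.continuous_iff.1 hGc x (min δ (G x / 2))
    (lt_min hδ (half_pos hGx))
  simp only [Real.dist_eq] at hcont
  refine ⟨ε * (G x / 2 / (u₁ + u₂)), by positivity, min (min δ δ') (x - a),
    lt_min (lt_min hδ hδ') (sub_pos.2 hx.1), fun x' hx' hlt => ?_⟩
  obtain ⟨hlt, hlta⟩ := lt_min_iff.1 hlt
  obtain ⟨hltd, hltd'⟩ := lt_min_iff.1 hlt
  have hx'I : x' ∈ Set.Icc a (u₁ + u₂) := ⟨by linarith [(abs_lt.1 hlta).1], hx'.2⟩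
  obtain ⟨g1, g2⟩ := lt_min_iff.1 (hcont x' hltd')
  have g3 : G x / 2 < G x' := by linarith [(abs_lt.1 g2).1]
  have hx'0 : 0 < x' := (add_pos h₁.l_pos h₂.l_pos).trans_le hx'.1
  -- Since `x * G x` is nonincreasing, a growth of `x` costs a proportional drop of `G`; `G x / 2`
  -- bounds `G` from below near `x`.
  have hG' : G x / 2 / (u₁ + u₂) * |x' - x| ≤ |G x' - G x| := by
    rw [div_mul_eq_mul_div, div_le_iff₀ hu0]
    rcases lt_trichotomy x x' with hlt | rfl | hlt
    · have m1 := (mul_sub_mul_of_upperTight h₁ h₂ hG hS hpos hxI hx'I hlt).1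
      have m2 : 0 ≤ G x - G x' := by nlinarith
      rw [abs_of_pos (sub_pos.2 hlt), abs_sub_comm, abs_of_nonneg m2]
      have : G x / 2 * (x' - x) ≤ G x' * (x' - x) :=
        mul_le_mul_of_nonneg_right g3.le (sub_nonneg.2 hlt.le)
      nlinarith [mul_nonneg m2 (sub_nonneg.2 hx.2)]
    · simp
    · have m1 := (mul_sub_mul_of_upperTight h₁ h₂ hG hS hpos hx'I hxI hlt).1
      have m2 : 0 ≤ G x' - G x := by nlinarith
      rw [abs_sub_comm, abs_of_pos (sub_pos.2 hlt), abs_of_nonneg m2]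
      nlinarith [mul_nonneg m2 (sub_nonneg.2 hx'.2)]
  calc ε * (G x / 2 / (u₁ + u₂)) * |x' - x| = ε * (G x / 2 / (u₁ + u₂) * |x' - x|) := by ring
    _ ≤ ε * |G x' - G x| := mul_le_mul_of_nonneg_left hG' hε.le
    _ ≤ _ := e x' hx'I hltd g1

end UpperPart

/-- The equivalent capacity function of two links in parallel. -/
theorem CapProfile.exists_parallel {l₁ o₁ a₁ b₁ u₁ l₂ o₂ a₂ b₂ u₂ : ℝ} {C₁ C₂ : ℝ → ℝ}
    (h₁ : CapProfile l₁ o₁ a₁ b₁ u₁ C₁) (h₂ : CapProfile l₂ o₂ a₂ b₂ u₂ C₂) :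
    ∃ o a b C, CapProfile (l₁ + l₂) o a b (u₁ + u₂) C ∧
      IsMaxMin (Set.Icc l₁ u₁) (Set.Icc l₂ u₂) (Set.Icc (l₁ + l₂) (u₁ + u₂))
        (fun x => C₁ x / x) (fun x => C₂ x / x) (fun x => C x / x) ∧
      ((∀ x ∈ Set.Ico l₁ o₁, SteepAt (Set.Icc l₁ u₁) (fun x => C₁ x / x) x) →
        (∀ x ∈ Set.Ico l₂ o₂, SteepAt (Set.Icc l₂ u₂) (fun x => C₂ x / x) x) →
        ∀ x ∈ Set.Ico (l₁ + l₂) o,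
          SteepAt (Set.Icc (l₁ + l₂) (u₁ + u₂)) (fun x => C x / x) x) ∧
      ((∀ x ∈ Set.Ioc b₁ u₁, SteepAt (Set.Icc l₁ u₁) C₁ x) →
        (∀ x ∈ Set.Ioc b₂ u₂, SteepAt (Set.Icc l₂ u₂) C₂ x) →
        ∀ x ∈ Set.Ioc b (u₁ + u₂), SteepAt (Set.Icc (l₁ + l₂) (u₁ + u₂)) C x) := by
  have hl0 : 0 < l₁ + l₂ := add_pos h₁.l_pos h₂.l_pos
  obtain ⟨G, hGc, hG⟩ := exists_maxMin_convolution h₁.l_le_u h₂.l_le_u h₁.ratio_continuousOn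
    h₂.ratio_continuousOn
  obtain ⟨o, a, hS⟩ := (h₁.ratio_isS0With.strictQuasi.maxMin_convolution
    h₂.ratio_isS0With.strictQuasi hG (convex_Icc _ _) (convex_Icc _ _)).exists_isS0With
    (add_le_add h₁.l_le_u h₂.l_le_u) hGc.continuousOn
  have hpos : ∀ x ∈ Set.Icc (l₁ + l₂) (u₁ + u₂), 0 < G x := by
    intro x hx
    obtain ⟨x₁, hx₁, x₂, hx₂, rfl, -, -⟩ := (hG x (G x)).2 ⟨hx, le_rfl⟩
    exact (lt_min (h₁.ratio_pos hx₁) (h₂.ratio_pos hx₂)).trans_le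
      ((hG (x₁ + x₂) _).1 ⟨x₁, hx₁, x₂, hx₂, rfl, min_le_left _ _, min_le_right _ _⟩).2
  have hratio : ∀ x, 0 < x → x * G x / x = G x := fun x hx => mul_div_cancel_left₀ _ hx.ne'
  have hx0 : ∀ x, l₁ + l₂ ≤ x → 0 < x := fun x hx => hl0.trans_le hx
  have hle : ∀ x ∈ Set.Icc (l₁ + l₂) (u₁ + u₂), x * G x ≤ C₁ a₁ + C₂ a₂ := by
    intro x hx
    obtain ⟨x₁, hx₁, x₂, hx₂, rfl, hm₁, hm₂⟩ := (hG x (G x)).2 ⟨hx, le_rfl⟩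
    have e₁ := (h₁.mul_le_of_le_ratio hx₁ hm₁).trans (h₁.le_apply_a hx₁)
    have e₂ := (h₂.mul_le_of_le_ratio hx₂ hm₂).trans (h₂.le_apply_a hx₂)
    linarith
  have haI : a ∈ Set.Icc (l₁ + l₂) (u₁ + u₂) :=
    ⟨hS.fst_mem.1.trans hS.snd_mem.1, hS.snd_mem.2⟩
  have hanti : AntitoneOn (fun x => x * G x) (Set.Icc a (u₁ + u₂)) := by
    intro x hx x' hx' hxx
    rcases hxx.eq_or_lt with rfl | hxx
    · exact le_rfl
    · exact (mul_sub_mul_of_upperTight h₁ h₂ hG hS hpos hx hx' hxx).1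
  have hcont : Continuous fun x => x * G x := continuous_id.mul hGc
  -- The saturated value bounds `x * G x` everywhere, so if it is attained at all it is also the
  -- value at `a`: the only possible plateau starts at `a`.
  have hcrit : ∀ x ∈ Set.Icc a (u₁ + u₂), x * G x = C₁ a₁ + C₂ a₂ → x * G x = a * G a :=
    fun x hx he => le_antisymm (hanti ⟨le_rfl, haI.2⟩ hx hx.1) (he ▸ hle a haI)
  obtain ⟨b, hb, hbc, hba⟩ := exists_const_strictAnti haI.2 hcont.continuousOn hanti
    fun x hx x' hx' hxx he => hcrit x hx
      ((mul_sub_mul_of_upperTight h₁ h₂ hG hS hpos hx hx' hxx).2 he)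
  refine ⟨o, a, b, fun x => x * G x, ⟨hl0, hS.fst_mem.1, hS.snd_mem.1, hb.1, hb.2,
    hcont.continuousOn, fun x hx => mul_pos (hx0 x hx.1) (hpos x hx), ?_, ?_, hbc, hba⟩,
    ?_, ?_, ?_⟩
  · intro x hx y hy hxy
    simp only [hratio x (hx0 x hx.1), hratio y (hx0 y hy.1)]
    exact hS.strictMonoOn hx hy hxy
  · intro x hx
    rw [hratio x (hx0 x (hS.fst_mem.1.trans hx.1)), hratio o (hx0 o hS.fst_mem.1)]
    exact hS.const_on x hx
  · intro x m
    rw [hG x m]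
    exact and_congr_right fun hx => by simp only [hratio x (hx0 x hx.1)]
  · intro q₁ q₂ x hx
    obtain ⟨ε, hε, δ, hδ, e⟩ := steepAt_of_lowerTight h₁ h₂ hG hS q₁ q₂ hx
    refine ⟨ε, hε, δ, hδ, fun y hy hlt => ?_⟩
    simp only [hratio x (hx0 x hx.1), hratio y (hx0 y hy.1)]
    exact e y hy hlt
  · intro q₁ q₂ x hx
    have hxI : x ∈ Set.Icc a (u₁ + u₂) := ⟨hb.1.trans hx.1.le, hx.2⟩
    -- Saturation at `x > b` would repeat the value at `b`, against strict decrease.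
    refine steepAt_of_upperTight h₁ h₂ hG hGc hS hpos q₁ q₂ ⟨hb.1.trans_lt hx.1, hx.2⟩
      fun he => ?_
    have h3 := hba ⟨le_rfl, hb.2⟩ ⟨hx.1.le, hx.2⟩ hx.1
    have h4 := hbc b ⟨hb.1, le_rfl⟩
    have h5 := hcrit x hxI he
    simp only at h3 h4
    linarith

/-! ### Inversion of the weight and series composition -/

theorem inv_mem_Icc {l u x : ℝ} (hl : 0 < l) (hx : x ∈ Set.Icc l u) : x⁻¹ ∈ Set.Icc u⁻¹ l⁻¹ :=
  ⟨inv_anti₀ (hl.trans_le hx.1) hx.2, inv_anti₀ hl hx.1⟩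

theorem inv_mem_Icc_of_inv {l u x : ℝ} (hl : 0 < l) (hlu : l ≤ u) (hx : x ∈ Set.Icc u⁻¹ l⁻¹) :
    x⁻¹ ∈ Set.Icc l u := by
  have := inv_mem_Icc (inv_pos.2 (hl.trans_le hlu)) hx
  rwa [inv_inv, inv_inv] at this

/-- Inversion is bi-Lipschitz on `[l, u]`: `|r⁻¹ - x|` lies between `l * l` and `u * u` times `|r -
x⁻¹|`. -/
theorem SteepAt.comp_inv {l u x : ℝ} {f : ℝ → ℝ} (hl : 0 < l) (hx : x ∈ Set.Icc l u)
    (h : SteepAt (Set.Icc l u) f x) : SteepAt (Set.Icc u⁻¹ l⁻¹) (fun r => f r⁻¹) x⁻¹ := by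
  obtain ⟨ε, hε, δ, hδ, e⟩ := h
  have hx0 : 0 < x := hl.trans_le hx.1
  have hu0 : 0 < u := hx0.trans_le hx.2
  refine ⟨ε * (l * l), by positivity, δ / (u * u), by positivity, fun r hr hlt => ?_⟩
  have hr0 : 0 < r := (inv_pos.2 hu0).trans_le hr.1
  have hy := inv_mem_Icc_of_inv hl (hx.1.trans hx.2) hr
  set y := r⁻¹ with hyr
  have hy0 : 0 < y := hl.trans_le hy.1
  have heq : |y - x| = x * y * |r - x⁻¹| := by
    rw [abs_sub_comm, show x * y * |r - x⁻¹| = |x * y * (r - x⁻¹)| by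
      rw [abs_mul, abs_of_pos (mul_pos hx0 hy0)]]
    congr 1
    rw [hyr]
    field_simp
  have hup : x * y ≤ u * u := mul_le_mul hx.2 hy.2 hy0.le hu0.le
  have hlow : l * l ≤ x * y := mul_le_mul hx.1 hy.1 hl.le hx0.le
  rw [lt_div_iff₀ (by positivity)] at hlt
  have h1 := e y hy (by nlinarith [mul_le_mul_of_nonneg_right hup (abs_nonneg (r - x⁻¹))])
  simp only [inv_inv]
  refine le_trans ?_ h1
  rw [heq, mul_assoc]
  gcongr

namespace CapProfile

variable {l o a b u : ℝ} {C : ℝ → ℝ}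

/-- Exchanging series and parallel composition: the equivalent weight is inverted, and flow and
potential difference change roles. -/
theorem dual (h : CapProfile l o a b u C) :
    CapProfile u⁻¹ b⁻¹ a⁻¹ o⁻¹ l⁻¹ (fun r => r * C r⁻¹) := by
  have ho0 := h.pos_of_mem h.o_mem
  have ha0 := h.pos_of_mem h.a_mem
  have hb0 : 0 < b := ha0.trans_le h.a_le
  have hu0 : 0 < u := hb0.trans_le h.b_le
  have hr0 : ∀ r, u⁻¹ ≤ r → 0 < r := fun r hr => (inv_pos.2 hu0).trans_le hr
  have hmem : ∀ r ∈ Set.Icc u⁻¹ l⁻¹, r⁻¹ ∈ Set.Icc l u := fun r hr =>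
    inv_mem_Icc_of_inv h.l_pos h.l_le_u hr
  have hub : u⁻¹ ≤ b⁻¹ := inv_anti₀ hb0 h.b_le
  have hba : b⁻¹ ≤ a⁻¹ := inv_anti₀ ha0 h.a_le
  have hao : a⁻¹ ≤ o⁻¹ := inv_anti₀ ho0 h.o_le
  have hol : o⁻¹ ≤ l⁻¹ := inv_anti₀ h.l_pos h.le_o
  have hratio : ∀ r, 0 < r → r * C r⁻¹ / r = C r⁻¹ := fun r hr => mul_div_cancel_left₀ _ hr.ne'
  refine ⟨inv_pos.2 hu0, hub, hba, hao, hol, ?_, ?_, ?_, ?_, ?_, ?_⟩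
  · refine continuousOn_id.mul (h.continuousOn.comp ?_ hmem)
    exact continuousOn_inv₀.mono fun r hr => (hr0 r hr.1).ne'
  · exact fun r hr => mul_pos (hr0 r hr.1) (h.pos _ (hmem r hr))
  · intro r hr s hs hrs
    simp only [hratio r (hr0 r hr.1), hratio s (hr0 s hs.1)]
    exact h.strictAntiOn (inv_mem_Icc_of_inv hb0 h.b_le hs) (inv_mem_Icc_of_inv hb0 h.b_le hr)
      (inv_strictAnti₀ (hr0 r hr.1) hrs)
  · intro r hr
    rw [hratio r (hr0 r (hub.trans hr.1)), hratio _ (inv_pos.2 hb0), inv_inv,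
      h.const_on b ⟨h.a_le, le_rfl⟩]
    exact h.const_on _ (inv_mem_Icc_of_inv ha0 h.a_le hr)
  · intro r hr
    have h1 := h.ratio_const_on _ (inv_mem_Icc_of_inv ho0 h.o_le hr)
    rw [div_inv_eq_mul, mul_comm] at h1
    rw [h1, ← h.ratio_a, inv_inv, mul_comm, div_eq_mul_inv]
  · intro r hr s hs hrs
    have := h.ratio_strictMonoOn (inv_mem_Icc_of_inv h.l_pos h.le_o hs)
      (inv_mem_Icc_of_inv h.l_pos h.le_o hr)
      (inv_strictAnti₀ (hr0 r (hub.trans (hba.trans (hao.trans hr.1)))) hrs)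
    simpa only [div_inv_eq_mul, mul_comm] using this

/-- The dual capacity at `r` is the ratio `C x / x` at `x = r⁻¹`, so steepness of the ratio at the
lower end becomes steepness of the capacity at the upper end. -/
theorem steepAt_dual (h : CapProfile l o a b u C)
    (hq : ∀ x ∈ Set.Ico l o, SteepAt (Set.Icc l u) (fun x => C x / x) x) :
    ∀ r ∈ Set.Ioc o⁻¹ l⁻¹, SteepAt (Set.Icc u⁻¹ l⁻¹) (fun r => r * C r⁻¹) r := by
  intro r hr
  have ho0 := h.pos_of_mem h.o_mem
  have hr0 : 0 < r := (inv_pos.2 ho0).trans hr.1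
  have h1 : r⁻¹ ∈ Set.Ico l o :=
    ⟨(le_inv_comm₀ hr0 h.l_pos).1 hr.2, (inv_lt_comm₀ ho0 hr0).1 hr.1⟩
  have h2 := (hq _ h1).comp_inv h.l_pos ⟨h1.1, h1.2.le.trans h.o_mem.2⟩
  rw [inv_inv] at h2
  convert h2 using 2 with s
  rw [div_inv_eq_mul, mul_comm]

theorem steepAt_ratio_dual (h : CapProfile l o a b u C)
    (hq : ∀ x ∈ Set.Ioc b u, SteepAt (Set.Icc l u) C x) :
    ∀ r ∈ Set.Ico u⁻¹ b⁻¹, SteepAt (Set.Icc u⁻¹ l⁻¹) (fun r => r * C r⁻¹ / r) r := by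
  intro r hr
  have hb0 : 0 < b := (h.pos_of_mem h.a_mem).trans_le h.a_le
  have hu0 : 0 < u := hb0.trans_le h.b_le
  have hr0 : 0 < r := (inv_pos.2 hu0).trans_le hr.1
  have h1 : r⁻¹ ∈ Set.Ioc b u :=
    ⟨(lt_inv_comm₀ hr0 hb0).1 hr.2, (inv_le_comm₀ hu0 hr0).1 hr.1⟩
  obtain ⟨ε, hε, δ, hδ, e⟩ := (hq _ h1).comp_inv h.l_pos
    ⟨h.a_mem.1.trans (h.a_le.trans h1.1.le), h1.2⟩
  rw [inv_inv] at e
  refine ⟨ε, hε, δ, hδ, fun s hs hlt => ?_⟩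
  simp only [mul_div_cancel_left₀ _ hr0.ne',
    mul_div_cancel_left₀ _ ((inv_pos.2 hu0).trans_le hs.1).ne']
  exact e s hs hlt

end CapProfile

/-- A reformulation of the class `S₁` of positive functions in which the subgradient conditions are
replaced by conditions on the ratio `C x / x`. -/
def IsCapacity (l u : ℝ) (C : ℝ → ℝ) : Prop :=
  ∃ o a b, CapProfile l o a b u C ∧
    ∀ x ∈ Set.Ico l o, SteepAt (Set.Icc l u) (fun x => C x / x) x

/-- Dividing each constraint by the link weight gives `z / x ≤ Cᵢ xᵢ / xᵢ`, which the max-min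
convolution describes. -/
theorem IsCapacity.exists_parallel {l₁ u₁ l₂ u₂ : ℝ} {C₁ C₂ : ℝ → ℝ} (h₁ : IsCapacity l₁ u₁ C₁)
    (h₂ : IsCapacity l₂ u₂ C₂) :
    ∃ C, IsCapacity (l₁ + l₂) (u₁ + u₂) C ∧ ∀ x z,
      (∃ x₁ ∈ Set.Icc l₁ u₁, ∃ x₂ ∈ Set.Icc l₂ u₂, x₁ + x₂ = x ∧
        z * (x₁ / (x₁ + x₂)) ≤ C₁ x₁ ∧ z * (x₂ / (x₁ + x₂)) ≤ C₂ x₂) ↔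
      x ∈ Set.Icc (l₁ + l₂) (u₁ + u₂) ∧ z ≤ C x := by
  obtain ⟨o₁, a₁, b₁, h₁, q₁⟩ := h₁
  obtain ⟨o₂, a₂, b₂, h₂, q₂⟩ := h₂
  obtain ⟨o, a, b, C, hC, hG, q, -⟩ := h₁.exists_parallel h₂
  refine ⟨C, ⟨o, a, b, hC, q q₁ q₂⟩, fun x z => ?_⟩
  have hsplit : (∃ x₁ ∈ Set.Icc l₁ u₁, ∃ x₂ ∈ Set.Icc l₂ u₂, x₁ + x₂ = x ∧
      z * (x₁ / (x₁ + x₂)) ≤ C₁ x₁ ∧ z * (x₂ / (x₁ + x₂)) ≤ C₂ x₂) ↔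
      ∃ x₁ ∈ Set.Icc l₁ u₁, ∃ x₂ ∈ Set.Icc l₂ u₂, x₁ + x₂ = x ∧
        z / x ≤ C₁ x₁ / x₁ ∧ z / x ≤ C₂ x₂ / x₂ := by
    refine exists_congr fun x₁ => and_congr_right fun hx₁ => exists_congr fun x₂ =>
      and_congr_right fun hx₂ => and_congr_right ?_
    rintro rfl
    rw [le_div_iff₀ (h₁.pos_of_mem hx₁), le_div_iff₀ (h₂.pos_of_mem hx₂), mul_div_assoc',
      mul_div_assoc', div_mul_eq_mul_div, div_mul_eq_mul_div]
  rw [hsplit, hG x (z / x)]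
  refine and_congr_right fun hx => ?_
  rw [div_le_div_iff_of_pos_right (hC.pos_of_mem hx)]

/-- Inverse weights add, and the dual ratios are the capacities themselves, so this is the parallel
case for the duals. Dualising back exchanges the two ends, which is why `CapProfile.exists_parallel`
also carries steepness on the decreasing part. -/
theorem IsCapacity.exists_series {l₁ u₁ l₂ u₂ : ℝ} {C₁ C₂ : ℝ → ℝ} (h₁ : IsCapacity l₁ u₁ C₁)
    (h₂ : IsCapacity l₂ u₂ C₂) :
    ∃ C, IsCapacity (l₁⁻¹ + l₂⁻¹)⁻¹ (u₁⁻¹ + u₂⁻¹)⁻¹ C ∧ ∀ x z,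
      (∃ x₁ ∈ Set.Icc l₁ u₁, ∃ x₂ ∈ Set.Icc l₂ u₂, (x₁⁻¹ + x₂⁻¹)⁻¹ = x ∧
        z ≤ C₁ x₁ ∧ z ≤ C₂ x₂) ↔
      x ∈ Set.Icc (l₁⁻¹ + l₂⁻¹)⁻¹ (u₁⁻¹ + u₂⁻¹)⁻¹ ∧ z ≤ C x := by
  obtain ⟨o₁, a₁, b₁, h₁, q₁⟩ := h₁
  obtain ⟨o₂, a₂, b₂, h₂, q₂⟩ := h₂
  obtain ⟨o, a, b, D, hD, hG, -, q⟩ := h₁.dual.exists_parallel h₂.dual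
  refine ⟨fun x => x * D x⁻¹, ⟨b⁻¹, a⁻¹, o⁻¹, hD.dual, hD.steepAt_ratio_dual
    (q (h₁.steepAt_dual q₁) (h₂.steepAt_dual q₂))⟩, fun x z => ?_⟩
  have hu0 : 0 < u₁⁻¹ + u₂⁻¹ := hD.l_pos
  have hspec := hG x⁻¹ z
  beta_reduce at hspec
  constructor
  · rintro ⟨x₁, hx₁, x₂, hx₂, rfl, hz₁, hz₂⟩
    have k₁ := inv_pos.2 (h₁.pos_of_mem hx₁)
    have k₂ := inv_pos.2 (h₂.pos_of_mem hx₂)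
    rw [inv_inv] at hspec
    obtain ⟨m1, m2⟩ := hspec.1 ⟨x₁⁻¹, inv_mem_Icc h₁.l_pos hx₁, x₂⁻¹, inv_mem_Icc h₂.l_pos hx₂,
      rfl, by rwa [mul_div_cancel_left₀ _ k₁.ne', inv_inv],
      by rwa [mul_div_cancel_left₀ _ k₂.ne', inv_inv]⟩
    refine ⟨inv_mem_Icc hu0 m1, ?_⟩
    beta_reduce
    rwa [inv_inv, mul_comm, ← div_eq_mul_inv]
  · rintro ⟨hx, hz⟩
    have hx' := inv_mem_Icc_of_inv hu0 hD.l_le_u hx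
    obtain ⟨r₁, hr₁, r₂, hr₂, hrr, m₁, m₂⟩ := hspec.2
      ⟨hx', by rwa [div_inv_eq_mul, mul_comm]⟩
    rw [mul_div_cancel_left₀ _ (h₁.dual.pos_of_mem hr₁).ne'] at m₁
    rw [mul_div_cancel_left₀ _ (h₂.dual.pos_of_mem hr₂).ne'] at m₂
    exact ⟨r₁⁻¹, inv_mem_Icc_of_inv h₁.l_pos h₁.l_le_u hr₁, r₂⁻¹,
      inv_mem_Icc_of_inv h₂.l_pos h₂.l_le_u hr₂, by rw [inv_inv, inv_inv, hrr, inv_inv], m₁, m₂⟩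

/-! ### The class `S₁` and the ratio `C x / x` -/

/-- A continuous increasing function whose lower derivative vanishes at every interior point is
constant. -/
theorem eq_of_frequently_slope_lt {g : ℝ → ℝ} {p q : ℝ} (hpq : p ≤ q)
    (hc : ContinuousOn g (Set.Icc p q)) (hm : MonotoneOn g (Set.Icc p q))
    (hf : ∀ x ∈ Set.Ioo p q, ∀ ε > 0, ∃ᶠ y in 𝓝[≠] x, (g y - g x) / (y - x) < ε) :
    g p = g q := by
  have hGc : Continuous (Set.IccExtend hpq (Set.domRestrict (Set.Icc p q) g)) :=
    hc.domRestrict.Icc_extend'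
  have hGm : Monotone (Set.IccExtend hpq (Set.domRestrict (Set.Icc p q) g)) :=
    Monotone.IccExtend (h := hpq) fun x y hxy => hm x.2 y.2 hxy
  have hGe : ∀ x ∈ Set.Icc p q, Set.IccExtend hpq (Set.domRestrict (Set.Icc p q) g) x = g x :=
    fun x hx => by rw [Set.IccExtend_of_mem _ _ hx]; rfl
  have hGb : ∀ x, g p ≤ Set.IccExtend hpq (Set.domRestrict (Set.Icc p q) g) x ∧
      Set.IccExtend hpq (Set.domRestrict (Set.Icc p q) g) x ≤ g q := fun x =>
    ⟨hm ⟨le_rfl, hpq⟩ (Set.projIcc p q hpq x).2 (Set.projIcc p q hpq x).2.1,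
      hm (Set.projIcc p q hpq x).2 ⟨hpq, le_rfl⟩ (Set.projIcc p q hpq x).2.2⟩
  generalize Set.IccExtend hpq (Set.domRestrict (Set.Icc p q) g) = G at hGc hGm hGe hGb
  -- In the variable `s = x + G x` the inverse `X` is Lipschitz, hence differentiable almost
  -- everywhere, and `s - X s` is `G`. The vanishing lower derivative of `G` forces `X' = 1` almost
  -- everywhere, so the Lipschitz function `s - X s` is constant.
  set S : ℝ → ℝ := fun x => x + G x with hS
  have hSc : Continuous S := continuous_id.add hGc
  have hSm : StrictMono S := strictMono_id.add_monotone hGm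
  have hSs : Function.Surjective S := by
    refine hSc.surjective ?_ ?_
    · exact tendsto_atTop_mono (fun x => add_le_add_right (hGb x).1 x)
        (tendsto_atTop_add_const_right _ (g p) tendsto_id)
    · exact tendsto_atBot_mono (fun x => add_le_add_right (hGb x).2 x)
        (tendsto_atBot_add_const_right _ (g q) tendsto_id)
  obtain ⟨X, hX⟩ := hSs.hasRightInverse
  have hXS : ∀ x, X (S x) = x := fun x => hSm.injective (hX (S x))
  have hSa : AntilipschitzWith 1 S := by
    refine AntilipschitzWith.of_le_mul_dist fun x y => ?_
    rw [NNReal.coe_one, one_mul, Real.dist_eq, Real.dist_eq]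
    rcases le_total x y with hxy | hxy
    · have := hGm hxy
      rw [abs_of_nonpos (sub_nonpos.2 hxy), abs_of_nonpos (sub_nonpos.2 (hSm.monotone hxy))]
      simp only [hS]
      linarith
    · have := hGm hxy
      rw [abs_of_nonneg (sub_nonneg.2 hxy), abs_of_nonneg (sub_nonneg.2 (hSm.monotone hxy))]
      simp only [hS]
      linarith
  have hXl : LipschitzWith 1 X := hSa.to_rightInverse hX
  have hac : AbsolutelyContinuousOnInterval (fun s => s - X s) (S p) (S q) :=
    ((LipschitzWith.id.sub hXl).lipschitzOnWith).absolutelyContinuousOnInterval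
  have hder : ∀ᵐ s, s ∈ Set.uIcc (S p) (S q) → HasDerivAt (fun s => s - X s) 0 s := by
    filter_upwards [hXl.ae_differentiableAt_real, MeasureTheory.Measure.ae_ne
      MeasureTheory.volume (S p), MeasureTheory.Measure.ae_ne MeasureTheory.volume (S q)]
      with s hd hsp hsq hs
    rw [Set.uIcc_of_le (hSm.monotone hpq)] at hs
    obtain ⟨x, rfl⟩ := hSs s
    have hx : x ∈ Set.Ioo p q := ⟨hSm.lt_iff_lt.1 (lt_of_le_of_ne hs.1 (Ne.symm hsp)),
      hSm.lt_iff_lt.1 (lt_of_le_of_ne hs.2 hsq)⟩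
    have hd1 : deriv X (S x) ≤ 1 := by
      have := norm_deriv_le_of_lipschitz hXl (x₀ := S x)
      exact (le_abs_self _).trans (by simpa using this)
    have hd2 : 1 ≤ deriv X (S x) := by
      by_contra! hlt
      obtain ⟨r, hr, hr1⟩ := exists_between (max_lt hlt one_pos)
      obtain ⟨hr, hr0⟩ := max_lt_iff.1 hr
      have hslope := (hasDerivAt_iff_tendsto_slope.1 hd.hasDerivAt).eventually_lt_const hr
      have htend : Tendsto S (𝓝[≠] x) (𝓝[≠] (S x)) :=
        hSc.continuousAt.continuousWithinAt.tendsto_nhdsWithin fun y hy =>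
          fun he => hy (hSm.injective he)
      -- With this `ε`, slopes of `G` below `ε` correspond to slopes of `X` above `r`, while those
      -- are eventually below `r`.
      have hε : 0 < 1 / r - 1 := by
        rw [sub_pos, lt_div_iff₀ hr0]
        linarith
      obtain ⟨y, hy1, ⟨hy2, hy3⟩, hy4⟩ := ((hf x hx _ hε).and_eventually
        ((htend.eventually hslope).and (nhdsWithin_le_nhds (Ioo_mem_nhds hx.1 hx.2)) |>.and
          self_mem_nhdsWithin)).exists
      have hyx : y - x ≠ 0 := sub_ne_zero.2 hy4
      rw [← hGe y (Set.Ioo_subset_Icc_self hy3), ← hGe x (Set.Ioo_subset_Icc_self hx)] at hy1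
      have hnn : 0 ≤ (G y - G x) / (y - x) := by
        rcases le_total x y with hxy | hxy
        · exact div_nonneg (sub_nonneg.2 (hGm hxy)) (sub_nonneg.2 hxy)
        · exact div_nonneg_of_nonpos (sub_nonpos.2 (hGm hxy)) (sub_nonpos.2 hxy)
      have hval : slope X (S x) (S y) = 1 / (1 + (G y - G x) / (y - x)) := by
        have : S y - S x = (y - x) * (1 + (G y - G x) / (y - x)) := by
          simp only [hS]
          field_simp
          ring
        rw [slope_def_field, hXS, hXS, this, div_mul_eq_div_div, div_self hyx]
      rw [hval, div_lt_iff₀ (by linarith)] at hy2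
      rw [lt_sub_iff_add_lt, lt_div_iff₀ hr0] at hy1
      linarith
    have hd3 : deriv X (S x) = 1 := le_antisymm hd1 hd2
    have := (hasDerivAt_id (S x)).sub hd.hasDerivAt
    rw [hd3, sub_self] at this
    exact this
  obtain ⟨c, hc⟩ := hac.const_of_ae_hasDerivAt_zero hder
  have e1 := hc _ Set.left_mem_uIcc
  have e2 := hc _ Set.right_mem_uIcc
  rw [hXS] at e1 e2
  rw [← hGe p ⟨le_rfl, hpq⟩, ← hGe q ⟨hpq, le_rfl⟩]
  simp only [hS] at e1 e2
  linarith

/-- A mean value inequality for the lower right derivative, applied to `-f` with a constant barrier.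
-/
theorem monotoneOn_of_eventually_slope_ge {f : ℝ → ℝ} {p q : ℝ} (hc : ContinuousOn f (Set.Icc p q))
    (hf : ∀ x ∈ Set.Ico p q, ∀ ε > 0, ∀ᶠ y in 𝓝[>] x, -ε < (f y - f x) / (y - x)) :
    MonotoneOn f (Set.Icc p q) := by
  intro x hx y hy hxy
  have h := image_le_of_liminf_slope_right_le_deriv_boundary (f := fun z => -f z) (a := x) (b := y)
    (B := fun _ => -f x) (B' := fun _ => 0)
    (hc.mono (Set.Icc_subset_Icc hx.1 hy.2)).neg le_rfl continuousOn_const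
    (fun z _ => hasDerivWithinAt_const _ _ _) (fun z hz r hr => by
      refine ((hf z ⟨hx.1.trans hz.1, hz.2.trans_le hy.2⟩ r hr).mono fun w hw => ?_).frequently
      rw [slope_def_field]
      have : (-f w - -f z) / (w - z) = -((f w - f z) / (w - z)) := by ring
      linarith) ⟨hxy, le_rfl⟩
  exact neg_le_neg_iff.1 h

/-- This identity translates comparisons of `min ∂ψ(x)` with `ψ x / x` into sign conditions on the
lower derivative of the ratio. -/
theorem slope_div_self {ψ : ℝ → ℝ} {x y : ℝ} (hx : 0 < x) (hy : 0 < y) (hxy : y ≠ x) :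
    (ψ y - ψ x) / (y - x) = ψ x / x + y * ((ψ y / y - ψ x / x) / (y - x)) := by
  have : y - x ≠ 0 := sub_ne_zero.2 hxy
  field_simp
  ring

theorem nhdsGT_le_nhdsWithin_Icc_diff {l u x : ℝ} (hl : l ≤ x) (hu : x < u) :
    𝓝[>] x ≤ 𝓝[Set.Icc l u \ {x}] x :=
  nhdsWithin_le_of_mem (mem_of_superset (Ioo_mem_nhdsGT hu) fun _ hy =>
    ⟨⟨hl.trans hy.1.le, hy.2.le⟩, hy.1.ne'⟩)

theorem exists_eventually_of_lt_minSubgradient {l u x : ℝ} {ψ : ℝ → ℝ} (hl : 0 < l)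
    (hx : x ∈ Set.Icc l u) (h : ((ψ x / x : ℝ) : EReal) < minSubgradient l u ψ x) :
    ∃ ε > 0, ∀ᶠ y in 𝓝[Set.Icc l u \ {x}] x, ε ≤ (ψ y / y - ψ x / x) / (y - x) := by
  obtain ⟨c, hc1, hc2⟩ := EReal.lt_iff_exists_real_btwn.1 h
  have hx0 : 0 < x := hl.trans_le hx.1
  have hc : 0 < c - ψ x / x := sub_pos.2 (EReal.coe_lt_coe_iff.1 hc1)
  -- The slope of the ratio enters `slope_div_self` with the factor `y ≤ u`.
  refine ⟨(c - ψ x / x) / u, div_pos hc (hx0.trans_le hx.2), ?_⟩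
  filter_upwards [eventually_lt_of_lt_liminf hc2, self_mem_nhdsWithin] with y hy hyI
  have hy0 : 0 < y := hl.trans_le hyI.1.1
  have hy' := EReal.coe_lt_coe_iff.1 hy
  rw [slope_div_self hx0 hy0 hyI.2] at hy'
  have h1 : c - ψ x / x ≤ y * ((ψ y / y - ψ x / x) / (y - x)) := by linarith
  have h2 : 0 ≤ (ψ y / y - ψ x / x) / (y - x) := by
    by_contra! hneg
    nlinarith
  rw [div_le_iff₀ (hx0.trans_le hx.2)]
  nlinarith [hyI.1.2]

theorem eventually_frequently_of_minSubgradient_eq {l u x : ℝ} {ψ : ℝ → ℝ} (hl : 0 < l)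
    (hx : x ∈ Set.Icc l u) (h : minSubgradient l u ψ x = ((ψ x / x : ℝ) : EReal)) :
    ∀ ε > 0, (∀ᶠ y in 𝓝[Set.Icc l u \ {x}] x, -ε < (ψ y / y - ψ x / x) / (y - x)) ∧
      ∃ᶠ y in 𝓝[Set.Icc l u \ {x}] x, (ψ y / y - ψ x / x) / (y - x) < ε := by
  intro ε hε
  have hx0 : 0 < x := hl.trans_le hx.1
  constructor
  · have h1 : ((ψ x / x - l * ε : ℝ) : EReal) < minSubgradient l u ψ x := by
      rw [h, EReal.coe_lt_coe_iff]
      nlinarith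
    filter_upwards [eventually_lt_of_lt_liminf h1, self_mem_nhdsWithin] with y hy hyI
    have hy0 : 0 < y := hl.trans_le hyI.1.1
    have hy' := EReal.coe_lt_coe_iff.1 hy
    rw [slope_div_self hx0 hy0 hyI.2] at hy'
    by_contra! hneg
    nlinarith [hyI.1.1]
  · have h1 : minSubgradient l u ψ x < ((ψ x / x + l * ε : ℝ) : EReal) := by
      rw [h, EReal.coe_lt_coe_iff]
      nlinarith
    refine ((frequently_lt_of_liminf_lt (by isBoundedDefault) h1).and_eventually
      self_mem_nhdsWithin).mono fun y ⟨hy, hyI⟩ => ?_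
    have hy0 : 0 < y := hl.trans_le hyI.1.1
    have hy' := EReal.coe_lt_coe_iff.1 hy
    rw [slope_div_self hx0 hy0 hyI.2] at hy'
    by_contra! hneg
    nlinarith [hyI.1.1]

/-- The ratio is nondecreasing up to `a` because its lower derivative is nonnegative. It increases
strictly where that derivative is positive, and `eq_of_frequently_slope_lt` makes it constant where
the derivative vanishes. -/
theorem IsS1.isCapacity {l u : ℝ} {ψ : ℝ → ℝ} (h : IsS1 l u ψ)
    (hpos : ∀ x ∈ Set.Icc l u, 0 < ψ x) : IsCapacity l u ψ := by
  obtain ⟨hl, a, b, hS, o, ho, h1, h2⟩ := h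
  have ha := hS.fst_mem
  have hI : ∀ x ∈ Set.Ico l a, x ∈ Set.Icc l u := fun x hx => ⟨hx.1, hx.2.le.trans ha.2⟩
  have hcont : ContinuousOn (fun x => ψ x / x) (Set.Icc l u) :=
    hS.continuousOn.div continuousOn_id fun x hx => (hl.trans_le hx.1).ne'
  have hst : ∀ x ∈ Set.Ico l o, ∃ ε > 0,
      ∀ᶠ y in 𝓝[Set.Icc l u \ {x}] x, ε ≤ (ψ y / y - ψ x / x) / (y - x) := fun x hx =>
    exists_eventually_of_lt_minSubgradient hl (hI x ⟨hx.1, hx.2.trans_le ho.2⟩) (h1 x hx)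
  have hmono : MonotoneOn (fun x => ψ x / x) (Set.Icc l a) := by
    refine monotoneOn_of_eventually_slope_ge (hcont.mono (Set.Icc_subset_Icc le_rfl ha.2))
      fun x hx ε hε => ?_
    refine Filter.Eventually.filter_mono
      (nhdsGT_le_nhdsWithin_Icc_diff hx.1 (hx.2.trans_le ha.2)) ?_
    rcases lt_or_ge x o with hxo | hox
    · obtain ⟨ε', hε', he⟩ := hst x ⟨hx.1, hxo⟩
      exact he.mono fun y hy => by linarith
    · exact (eventually_frequently_of_minSubgradient_eq hl (hI x hx) (h2 x ⟨hox, hx.2⟩) ε hε).1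
  refine ⟨o, a, b, ⟨hl, ho.1, ho.2, hS.snd_mem.1, hS.snd_mem.2, hS.continuousOn, hpos, ?_, ?_,
    hS.const_on, hS.strictAntiOn⟩, ?_⟩
  · intro x hx y hy hxy
    obtain ⟨ε, hε, he⟩ := hst x ⟨hx.1, hxy.trans_le hy.2⟩
    have hyu : y ≤ u := hy.2.trans (ho.2.trans ha.2)
    obtain ⟨w, hw, hwI⟩ := ((he.filter_mono (nhdsGT_le_nhdsWithin_Icc_diff hx.1
      (hxy.trans_le hyu))).and (Ioo_mem_nhdsGT hxy)).exists
    have hlt : ψ x / x < ψ w / w := by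
      have := mul_pos (hε.trans_le hw) (sub_pos.2 hwI.1)
      rw [div_mul_cancel₀ _ (sub_pos.2 hwI.1).ne'] at this
      linarith
    exact hlt.trans_le (hmono ⟨hx.1.trans hwI.1.le, hwI.2.le.trans (hy.2.trans ho.2)⟩
      ⟨hy.1, hy.2.trans ho.2⟩ hwI.2.le)
  · have hoa : ψ o / o = ψ a / a := by
      refine eq_of_frequently_slope_lt (g := fun x => ψ x / x) ho.2
        (hcont.mono (Set.Icc_subset_Icc ho.1 ha.2))
        (hmono.mono (Set.Icc_subset_Icc ho.1 le_rfl)) fun x hx ε hε => ?_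
      exact (eventually_frequently_of_minSubgradient_eq hl (hI x ⟨ho.1.trans hx.1.le, hx.2⟩)
        (h2 x ⟨hx.1.le, hx.2⟩) ε hε).2.filter_mono (nhdsWithin_mono _ fun y hy => hy.2)
    intro x hx
    refine le_antisymm ?_ (hmono ⟨ho.1, ho.2⟩ ⟨ho.1.trans hx.1, hx.2⟩ hx.1)
    rw [hoa]
    exact hmono ⟨ho.1.trans hx.1, hx.2⟩ ⟨ha.1, le_rfl⟩ hx.2
  · intro x hx
    obtain ⟨ε, hε, he⟩ := hst x hx
    obtain ⟨δ, hδ, hball⟩ := Metric.eventually_nhds_iff.1 (eventually_nhdsWithin_iff.1 he)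
    refine ⟨ε, hε, δ, hδ, fun y hy hlt => ?_⟩
    rcases eq_or_ne y x with rfl | hne
    · simp
    · have h3 := hball hlt ⟨hy, hne⟩
      have h4 := h3.trans (le_abs_self _)
      rwa [abs_div, le_div_iff₀ (abs_pos.2 (sub_ne_zero.2 hne))] at h4

theorem IsCapacity.isS1 {l u : ℝ} {C : ℝ → ℝ} (h : IsCapacity l u C) : IsS1 l u C := by
  obtain ⟨o, a, b, h, hq⟩ := h
  refine ⟨h.l_pos, a, b, h.isS0With, o, ⟨h.le_o, h.o_le⟩, fun x hx => ?_, fun x hx => ?_⟩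
  · have hxI : x ∈ Set.Icc l u := ⟨hx.1, hx.2.le.trans h.o_mem.2⟩
    obtain ⟨ε, hε, δ, hδ, e⟩ := hq x hx
    -- Near `x`, `l * ε` bounds `y` times the slope of the ratio from below, so the inequality stays
    -- strict in the lower limit.
    have hlt : ((C x / x : ℝ) : EReal) < ((C x / x + l * ε : ℝ) : EReal) := by
      rw [EReal.coe_lt_coe_iff]
      nlinarith [h.l_pos]
    refine hlt.trans_le (le_liminf_of_le (by isBoundedDefault) ?_)
    filter_upwards [self_mem_nhdsWithin, nhdsWithin_le_nhds (Metric.ball_mem_nhds x hδ),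
      nhdsWithin_le_nhds (Iio_mem_nhds hx.2)] with y hyI hyb hyo
    have hy0 := h.pos_of_mem hyI.1
    have h1 := e y hyI.1 hyb
    have hne : y ≠ x := hyI.2
    have h2 : ε ≤ (C y / y - C x / x) / (y - x) := by
      rcases lt_or_gt_of_ne hne with hyx | hxy
      · have h3 := h.ratio_strictMonoOn ⟨hyI.1.1, (le_of_lt hyo)⟩ ⟨hx.1, hx.2.le⟩ hyx
        rw [abs_of_neg (sub_neg.2 hyx), abs_of_neg (sub_neg.2 h3)] at h1
        rw [le_div_iff_of_neg (sub_neg.2 hyx)]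
        linarith
      · have h3 := h.ratio_strictMonoOn ⟨hx.1, hx.2.le⟩ ⟨hyI.1.1, (le_of_lt hyo)⟩ hxy
        rw [abs_of_pos (sub_pos.2 hxy), abs_of_pos (sub_pos.2 h3)] at h1
        rwa [le_div_iff₀ (sub_pos.2 hxy)]
    rw [EReal.coe_le_coe_iff, slope_div_self (h.pos_of_mem hxI) hy0 hne]
    have h4 := mul_le_mul hyI.1.1 h2 hε.le hy0.le
    linarith
  · have hxl : l ≤ x := h.le_o.trans hx.1
    have hxu : x < u := hx.2.trans_le h.a_mem.2
    have hx0 : 0 < x := h.l_pos.trans_le hxl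
    -- Just to the right of `x` the ratio is constant and the quotients equal `C x / x`; on either
    -- side they are no smaller, as the ratio is nondecreasing.
    refine le_antisymm (liminf_le_of_frequently_le' ?_) (le_liminf_of_le (by isBoundedDefault) ?_)
    · have hev : ∀ᶠ y in 𝓝[>] x,
          (((C y - C x) / (y - x) : ℝ) : EReal) ≤ ((C x / x : ℝ) : EReal) := by
        filter_upwards [Ioo_mem_nhdsGT hx.2] with y hy
        rw [EReal.coe_le_coe_iff, slope_div_self hx0 (hx0.trans hy.1) hy.1.ne',
          h.ratio_const_on y ⟨hx.1.trans hy.1.le, hy.2.le⟩, h.ratio_const_on x ⟨hx.1, hx.2.le⟩]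
        simp
      exact hev.frequently.filter_mono (nhdsGT_le_nhdsWithin_Icc_diff hxl hxu)
    · filter_upwards [self_mem_nhdsWithin, nhdsWithin_le_nhds (Iio_mem_nhds hx.2)] with y hyI hya
      have hy0 := h.pos_of_mem hyI.1
      rw [EReal.coe_le_coe_iff, slope_div_self hx0 hy0 hyI.2]
      have : 0 ≤ (C y / y - C x / x) / (y - x) := by
        rcases le_total x y with hxy | hyx
        · exact div_nonneg (sub_nonneg.2 (h.ratio_monotoneOn ⟨hxl, hx.2.le⟩
            ⟨hyI.1.1, (le_of_lt hya)⟩ hxy)) (sub_nonneg.2 hxy)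
        · exact div_nonneg_of_nonpos (sub_nonpos.2 (h.ratio_monotoneOn
            ⟨hyI.1.1, (le_of_lt hya)⟩ ⟨hxl, hx.2.le⟩ hyx)) (sub_nonpos.2 hyx)
      nlinarith

theorem IsCapacity.congr {l u : ℝ} {C D : ℝ → ℝ} (h : IsCapacity l u C)
    (he : Set.EqOn C D (Set.Icc l u)) : IsCapacity l u D := by
  obtain ⟨o, a, b, h, hq⟩ := h
  have hau := h.a_mem.2
  have hlo : Set.Icc l o ⊆ Set.Icc l u := Set.Icc_subset_Icc le_rfl h.o_mem.2
  have hr : ∀ x ∈ Set.Icc l u, C x / x = D x / x := fun x hx => by rw [he hx]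
  refine ⟨o, a, b, ⟨h.l_pos, h.le_o, h.o_le, h.a_le, h.b_le, h.continuousOn.congr he.symm,
    fun x hx => he hx ▸ h.pos x hx, h.ratio_strictMonoOn.congr fun x hx => hr x (hlo hx),
    fun x hx => ?_, fun x hx => ?_, h.strictAntiOn.congr fun x hx =>
      he ⟨h.a_mem.1.trans (h.a_le.trans hx.1), hx.2⟩⟩, fun x hx => ?_⟩
  · rw [← hr x ⟨h.le_o.trans hx.1, hx.2.trans hau⟩, ← hr o h.o_mem]
    exact h.ratio_const_on x hx
  · rw [← he ⟨h.a_mem.1.trans hx.1, hx.2.trans h.b_le⟩, ← he h.a_mem]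
    exact h.const_on x hx
  · obtain ⟨ε, hε, δ, hδ, e⟩ := hq x hx
    refine ⟨ε, hε, δ, hδ, fun y hy hlt => ?_⟩
    have := e y hy hlt
    beta_reduce at this ⊢
    rwa [hr y hy, hr x (hlo ⟨hx.1, hx.2.le⟩)] at this

/-! ### Series-parallel trees -/

/-- A series-parallel composition of links, each with a sign which tells whether the link is
directed along the composition. -/
inductive SPTree (E : Type*)
  | leaf (i : E) (ε : ℤˣ)
  | series (S T : SPTree E)
  | parallel (S T : SPTree E)

namespace SPTree

variable {E : Type*}

/-- The links of a composition. -/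
def leaves : SPTree E → Multiset E
  | leaf i _ => {i}
  | series S T => S.leaves + T.leaves
  | parallel S T => S.leaves + T.leaves

/-- The equivalent weight of a composition. -/
noncomputable def weight (w : E → ℝ) : SPTree E → ℝ
  | leaf i _ => w i
  | series S T => ((S.weight w)⁻¹ + (T.weight w)⁻¹)⁻¹
  | parallel S T => S.weight w + T.weight w

/-- The signed link flows under a unit flow through a composition. -/
noncomputable def share [DecidableEq E] (w : E → ℝ) : SPTree E → E → ℝ
  | leaf i ε => Pi.single i ((ε : ℤ) : ℝ)
  | series S T => S.share w + T.share w
  | parallel S T => (S.weight w / (S.weight w + T.weight w)) • S.share w +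
      (T.weight w / (S.weight w + T.weight w)) • T.share w

/-- The composition traversed in the opposite direction. -/
def rev : SPTree E → SPTree E
  | leaf i ε => leaf i (-ε)
  | series S T => series S.rev T.rev
  | parallel S T => parallel S.rev T.rev

@[simp] theorem leaves_rev (T : SPTree E) : T.rev.leaves = T.leaves := by
  induction T with
  | leaf i ε => rfl
  | series S T hS hT => simp [rev, leaves, hS, hT]
  | parallel S T hS hT => simp [rev, leaves, hS, hT]

@[simp] theorem weight_rev (w : E → ℝ) (T : SPTree E) : T.rev.weight w = T.weight w := by
  induction T with
  | leaf i ε => rfl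
  | series S T hS hT => simp [rev, weight, hS, hT]
  | parallel S T hS hT => simp [rev, weight, hS, hT]

@[simp] theorem share_rev [DecidableEq E] (w : E → ℝ) (T : SPTree E) :
    T.rev.share w = -T.share w := by
  induction T with
  | leaf i ε => simp [rev, share, Pi.single_neg]
  | series S T hS hT => simp [rev, share, hS, hT, add_comm]
  | parallel S T hS hT => simp [rev, share, hS, hT, add_comm]

theorem weight_pos {w : E → ℝ} (hw : ∀ i, 0 < w i) (T : SPTree E) : 0 < T.weight w := by
  induction T with
  | leaf i ε => exact hw i
  | series S T hS hT => exact inv_pos.2 (add_pos (inv_pos.2 hS) (inv_pos.2 hT))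
  | parallel S T hS hT => exact add_pos hS hT

end SPTree

/-! ### Electrical networks -/

section Dipole

variable {V : Type*} [DecidableEq V]

theorem dipole_apply_left {a b : V} (h : a ≠ b) : dipole a b a = 1 := by
  simp [dipole, h]

theorem dipole_apply_right {a b : V} (h : a ≠ b) : dipole a b b = -1 := by
  simp [dipole, h.symm]

theorem dipole_apply_of_ne {a b v : V} (ha : v ≠ a) (hb : v ≠ b) : dipole a b v = 0 := by
  simp [dipole, ha, hb]

theorem dipole_add_dipole (a v b : V) : dipole a v + dipole v b = dipole a b := by
  simp [dipole]

theorem dipole_swap (a b : V) : dipole a b = -dipole b a := by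
  simp [dipole]

/-- A single remaining link that carries the whole supply must join `s` and `t`. -/
theorem eq_of_smul_dipole_eq {a b s t : V} {c : ℝ} (hst : s ≠ t)
    (h : c • dipole a b = dipole s t) : (a = s ∧ b = t) ∨ (a = t ∧ b = s) := by
  have hs := congrFun h s
  have ht := congrFun h t
  rw [dipole_apply_left hst] at hs
  rw [dipole_apply_right hst] at ht
  have hs' : s = a ∨ s = b := by
    by_contra! hcon
    simp [dipole_apply_of_ne hcon.1 hcon.2] at hs
  have ht' : t = a ∨ t = b := by
    by_contra! hcon
    simp [dipole_apply_of_ne hcon.1 hcon.2] at ht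
  grind

theorem dotProduct_dipole [Fintype V] (s t : V) (x : V → ℝ) : dipole s t ⬝ᵥ x = x s - x t := by
  simp [dipole, sub_dotProduct]

end Dipole

namespace DirectedMultigraph

variable {V E : Type*} [Fintype V] [DecidableEq V] [Fintype E] [DecidableEq E]

omit [Fintype V] [Fintype E] [DecidableEq E] in
theorem incidence_apply (G : DirectedMultigraph V E) (v : V) (i : E) :
    G.incidence v i = dipole (G.src i) (G.tgt i) v := by
  have := G.loopless i
  simp only [incidence, dipole, Pi.sub_apply, Pi.single_apply]
  split_ifs <;> grind

omit [Fintype E] [DecidableEq E] in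
theorem incidence_transpose_mulVec (G : DirectedMultigraph V E) (x : V → ℝ) (i : E) :
    G.incidence.transpose.mulVec x i = x (G.src i) - x (G.tgt i) := by
  rw [← dotProduct_dipole]
  simp only [Matrix.mulVec, dotProduct, Matrix.transpose_apply, incidence_apply]

theorem laplacian_mulVec (G : DirectedMultigraph V E) (w : E → ℝ) (x : V → ℝ) :
    (G.laplacian w).mulVec x =
      ∑ i, (w i * (x (G.src i) - x (G.tgt i))) • dipole (G.src i) (G.tgt i) := by
  funext v
  rw [laplacian, ← Matrix.mulVec_mulVec, ← Matrix.mulVec_mulVec, Finset.sum_apply]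
  simp only [Matrix.mulVec, dotProduct]
  refine Finset.sum_congr rfl fun i _ => ?_
  have h1 := G.incidence_transpose_mulVec x i
  simp only [Matrix.mulVec, dotProduct] at h1
  rw [← h1, incidence_apply, Pi.smul_apply, smul_eq_mul, mul_comm]
  simp [Matrix.diagonal_apply]

theorem flow_apply (G : DirectedMultigraph V E) (w : E → ℝ) (p : V → ℝ) (i : E) :
    G.flow w p i = w i * ((pinv (G.laplacian w)).mulVec p (G.src i) -
      (pinv (G.laplacian w)).mulVec p (G.tgt i)) := by
  rw [flow, ← Matrix.mulVec_mulVec, ← Matrix.mulVec_mulVec, Matrix.mulVec_diagonal,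
    incidence_transpose_mulVec]

omit [Fintype V] in
theorem laplacian_transpose (G : DirectedMultigraph V E) (w : E → ℝ) :
    (G.laplacian w).transpose = G.laplacian w := by
  simp [laplacian, Matrix.transpose_mul, Matrix.mul_assoc]

theorem dotProduct_laplacian_mulVec (G : DirectedMultigraph V E) (w : E → ℝ) (x : V → ℝ) :
    x ⬝ᵥ (G.laplacian w).mulVec x = ∑ i, w i * (x (G.src i) - x (G.tgt i)) ^ 2 := by
  rw [laplacian_mulVec, dotProduct_sum]
  refine Finset.sum_congr rfl fun i _ => ?_
  rw [dotProduct_smul, dotProduct_comm, dotProduct_dipole, smul_eq_mul]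
  ring

/-- The energy `xᵀ L x` is a sum of nonnegative link terms; its vanishing equalises `x` along every
link. -/
theorem eq_of_laplacian_mulVec_eq_zero (G : DirectedMultigraph V E) (hconn : G.WeaklyConnected)
    {w : E → ℝ} (hw : ∀ i, 0 < w i) {x : V → ℝ} (hx : (G.laplacian w).mulVec x = 0) (u v : V) :
    x u = x v := by
  have hnn : ∀ i ∈ Finset.univ, 0 ≤ w i * (x (G.src i) - x (G.tgt i)) ^ 2 := fun i _ =>
    mul_nonneg (hw i).le (sq_nonneg _)
  have hzero := G.dotProduct_laplacian_mulVec w x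
  rw [hx, dotProduct_zero, eq_comm, Finset.sum_eq_zero_iff_of_nonneg hnn] at hzero
  have hedge : ∀ i, x (G.src i) = x (G.tgt i) := fun i => by
    have := hzero i (Finset.mem_univ i)
    rw [mul_eq_zero, or_iff_right (hw i).ne', sq_eq_zero_iff, sub_eq_zero] at this
    exact this
  obtain ⟨W⟩ := hconn.preconnected u v
  induction W with
  | nil => rfl
  | cons h _ ih =>
    refine Eq.trans ?_ ih
    rw [SimpleGraph.fromRel_adj] at h
    rcases h.2 with ⟨i, rfl, rfl⟩ | ⟨i, rfl, rfl⟩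
    · exact hedge i
    · exact (hedge i).symm

/-- The residual lies in the kernel of `L`, hence is constant. It is therefore orthogonal to the
dipole and to the range of `L`, and so to itself. -/
theorem laplacian_mulVec_pinv (G : DirectedMultigraph V E) (hconn : G.WeaklyConnected)
    {w : E → ℝ} (hw : ∀ i, 0 < w i) (s t : V) :
    (G.laplacian w).mulVec ((pinv (G.laplacian w)).mulVec (dipole s t)) = dipole s t := by
  set L := G.laplacian w with hL
  have hsym : L.transpose = L := G.laplacian_transpose w
  have hP := pinv_spec L hsym
  have hLLP : L * (L * pinv L) = L := by
    have := congrArg Matrix.transpose hP.mul_mul_self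
    rwa [Matrix.transpose_mul, hP.left_symm, hsym] at this
  set q := dipole s t - L.mulVec ((pinv L).mulVec (dipole s t)) with hq
  have hLq : L.mulVec q = 0 := by
    rw [hq, Matrix.mulVec_sub, Matrix.mulVec_mulVec, Matrix.mulVec_mulVec,
      Matrix.mul_assoc, hLLP, sub_self]
  have hconst := G.eq_of_laplacian_mulVec_eq_zero hconn hw hLq
  have hqq : q ⬝ᵥ q = 0 := by
    calc q ⬝ᵥ q = q ⬝ᵥ (dipole s t - L.mulVec ((pinv L).mulVec (dipole s t))) := by rw [← hq]
      _ = 0 := by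
        rw [dotProduct_sub, dotProduct_comm q, dotProduct_dipole, hconst s t, sub_self,
          Matrix.dotProduct_mulVec, ← Matrix.mulVec_transpose, hsym, hLq, zero_dotProduct,
          sub_zero]
  rw [dotProduct_self_eq_zero, hq, sub_eq_zero] at hqq
  exact hqq.symm

/-! ### Reduction of a network -/

/-- The flow through a composite link at the node potentials `x`. -/
noncomputable def current (w : E → ℝ) (x : V → ℝ) (e : V × V × SPTree E) : ℝ :=
  e.2.2.weight w * (x e.1 - x e.2.1)

/-- The network with the composite links `M` has the same node potentials as `G` under the supply
and demand `p`, and determines the flows on the links of `G`. -/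
structure Represents (G : DirectedMultigraph V E) (p : V → ℝ)
    (M : Multiset (V × V × SPTree E)) : Prop where
  nodup : (M.bind fun e => e.2.2.leaves).Nodup
  kirchhoff : ∀ w : E → ℝ, (∀ i, 0 < w i) → ∀ x, (G.laplacian w).mulVec x = p →
    (M.map fun e => current w x e • dipole e.1 e.2.1).sum = p
  flow_eq : ∀ w : E → ℝ, (∀ i, 0 < w i) → ∀ x, (G.laplacian w).mulVec x = p →
    (fun i => w i * (x (G.src i) - x (G.tgt i))) =
      (M.map fun e => current w x e • e.2.2.share w).sum

/-- The end points of a composite link. -/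
def ends (e : V × V × SPTree E) : Sym2 V := s(e.1, e.2.1)

namespace Represents

variable {G : DirectedMultigraph V E} {p : V → ℝ} {M : Multiset (V × V × SPTree E)}

theorem initial (G : DirectedMultigraph V E) (p : V → ℝ) :
    Represents G p ((Finset.univ : Finset E).val.map fun i =>
      (G.src i, G.tgt i, SPTree.leaf i 1)) where
  nodup := by
    rw [Multiset.bind_map]
    change ((Finset.univ : Finset E).val.bind fun i => {id i}).Nodup
    rw [Multiset.bind_singleton, Multiset.map_id]
    exact (Finset.univ : Finset E).nodup
  kirchhoff w _ x hx := by
    rw [Multiset.map_map, ← hx, laplacian_mulVec]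
    rfl
  flow_eq w _ x _ := by
    rw [Multiset.map_map]
    funext i
    change _ = (∑ j, (w j * (x (G.src j) - x (G.tgt j))) •
      (Pi.single j (((1 : ℤˣ) : ℤ) : ℝ) : E → ℝ)) i
    rw [Finset.sum_apply]
    simp [Pi.single_apply]

theorem reverse {a b : V} {T : SPTree E} (h : Represents G p ((a, b, T) ::ₘ M)) :
    Represents G p ((b, a, T.rev) ::ₘ M) where
  nodup := by simpa using h.nodup
  kirchhoff w hw x hx := by
    rw [← h.kirchhoff w hw x hx, Multiset.map_cons, Multiset.map_cons, Multiset.sum_cons,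
      Multiset.sum_cons, dipole_swap b a]
    congr 1
    simp only [current, SPTree.weight_rev, smul_neg, ← neg_smul]
    congr 1
    ring
  flow_eq w hw x hx := by
    rw [h.flow_eq w hw x hx, Multiset.map_cons, Multiset.map_cons, Multiset.sum_cons,
      Multiset.sum_cons]
    congr 1
    simp only [current, SPTree.weight_rev, SPTree.share_rev, smul_neg, ← neg_smul]
    congr 1
    ring

/-- A reduction step names only end points, so the matching composite link is turned round if
needed. `K` keeps the links already picked out for the same step. -/
theorem exists_cons {K : Multiset (V × V × SPTree E)} {a b : V} {N : Multiset (Sym2 V)}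
    (h : Represents G p (K + M)) (hM : M.map ends = s(a, b) ::ₘ N) :
    ∃ T M', Represents G p ((a, b, T) ::ₘ (K + M')) ∧ M'.map ends = N := by
  classical
  obtain ⟨⟨a', b', T⟩, he, hends, hN⟩ := (Multiset.map_eq_cons _ _ _ _).2 hM
  rw [← Multiset.cons_erase he, Multiset.add_cons] at h
  rcases Sym2.eq_iff.1 hends with ⟨h1, h2⟩ | ⟨h1, h2⟩
  · simp only at h1 h2
    subst h1 h2
    exact ⟨T, _, h, hN⟩
  · simp only at h1 h2
    subst h1 h2
    exact ⟨T.rev, _, h.reverse, hN⟩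

omit [Fintype V] [Fintype E] [DecidableEq E] in
theorem sum_apply_eq_zero {N : Multiset (Sym2 V)} {v : V} (hM : M.map ends = N)
    (hv : ∀ l ∈ N, v ∉ l) (f : V × V × SPTree E → ℝ) :
    (M.map fun e => f e • dipole e.1 e.2.1).sum v = 0 := by
  have hev : ((M.map fun e => f e • dipole e.1 e.2.1).sum : V → ℝ) v =
      (M.map fun e => f e * dipole e.1 e.2.1 v).sum := by
    clear hM
    induction M using Multiset.induction_on with
    | empty => simp
    | cons e M ih => simp [ih]
  rw [hev]
  refine Multiset.sum_eq_zero fun y hy => ?_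
  obtain ⟨e, he, rfl⟩ := Multiset.mem_map.1 hy
  have h1 := hv _ (hM ▸ Multiset.mem_map_of_mem ends he)
  rw [ends, Sym2.mem_iff, not_or] at h1
  rw [dipole_apply_of_ne h1.1 h1.2, mul_zero]

/-- Kirchhoff's law at `v` forces the only link there to carry no flow. -/
theorem degreeOne {N : Multiset (Sym2 V)} {v u : V} {T : SPTree E}
    (h : Represents G p ((v, u, T) ::ₘ M)) (hvu : v ≠ u) (hp : p v = 0) (hM : M.map ends = N)
    (hv : ∀ l ∈ N, v ∉ l) : Represents G p M := by
  have hcur : ∀ w : E → ℝ, (∀ i, 0 < w i) → ∀ x, (G.laplacian w).mulVec x = p →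
      current w x (v, u, T) = 0 := by
    intro w hw x hx
    have h1 := congrFun (h.kirchhoff w hw x hx) v
    rw [Multiset.map_cons, Multiset.sum_cons, Pi.add_apply, sum_apply_eq_zero hM hv, hp,
      add_zero, Pi.smul_apply, dipole_apply_left hvu, smul_eq_mul, mul_one] at h1
    exact h1
  refine ⟨?_, fun w hw x hx => ?_, fun w hw x hx => ?_⟩
  · have h1 := h.nodup
    rw [Multiset.cons_bind, Multiset.nodup_add] at h1
    exact h1.2.1
  · have h1 := h.kirchhoff w hw x hx
    rwa [Multiset.map_cons, Multiset.sum_cons, hcur w hw x hx, zero_smul, zero_add] at h1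
  · have h1 := h.flow_eq w hw x hx
    rwa [Multiset.map_cons, Multiset.sum_cons, hcur w hw x hx, zero_smul, zero_add] at h1

/-- Kirchhoff's law at `v` makes the two currents equal, and hence equal to that of the equivalent
link. -/
theorem series {N : Multiset (Sym2 V)} {a v b : V} {S T : SPTree E}
    (h : Represents G p ((v, b, T) ::ₘ (a, v, S) ::ₘ M)) (hav : a ≠ v) (hvb : v ≠ b)
    (hp : p v = 0) (hM : M.map ends = N) (hv : ∀ l ∈ N, v ∉ l) :
    Represents G p ((a, b, S.series T) ::ₘ M) := by
  have hcur : ∀ w : E → ℝ, (∀ i, 0 < w i) → ∀ x, (G.laplacian w).mulVec x = p →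
      current w x (v, b, T) = current w x (a, b, S.series T) ∧
      current w x (a, v, S) = current w x (a, b, S.series T) := by
    intro w hw x hx
    have h1 := congrFun (h.kirchhoff w hw x hx) v
    rw [Multiset.map_cons, Multiset.sum_cons, Pi.add_apply, Multiset.map_cons, Multiset.sum_cons,
      Pi.add_apply, sum_apply_eq_zero hM hv, hp, add_zero, Pi.smul_apply, Pi.smul_apply,
      dipole_apply_left hvb, dipole_apply_right hav, smul_eq_mul, mul_one, smul_eq_mul] at h1
    have hS := SPTree.weight_pos hw S
    have hT := SPTree.weight_pos hw T
    simp only [current, SPTree.weight] at h1 ⊢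
    constructor
    · field_simp
      linear_combination h1
    · field_simp
      linear_combination -h1
  refine ⟨?_, fun w hw x hx => ?_, fun w hw x hx => ?_⟩
  · have h1 := h.nodup
    rw [Multiset.cons_bind, Multiset.cons_bind, ← add_assoc] at h1
    rw [Multiset.cons_bind, SPTree.leaves, add_comm S.leaves]
    exact h1
  · rw [← h.kirchhoff w hw x hx]
    simp only [Multiset.map_cons, Multiset.sum_cons]
    rw [(hcur w hw x hx).1, (hcur w hw x hx).2, ← add_assoc, ← smul_add, add_comm (dipole v b),
      dipole_add_dipole]
  · rw [h.flow_eq w hw x hx]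
    simp only [Multiset.map_cons, Multiset.sum_cons]
    rw [(hcur w hw x hx).1, (hcur w hw x hx).2, ← add_assoc, ← smul_add, SPTree.share,
      add_comm (T.share w)]

/-- Both links see the same potential difference, so the current splits in proportion to the
weights. -/
theorem parallel {a b : V} {S T : SPTree E}
    (h : Represents G p ((a, b, T) ::ₘ (a, b, S) ::ₘ M)) :
    Represents G p ((a, b, S.parallel T) ::ₘ M) := by
  refine ⟨?_, fun w hw x hx => ?_, fun w hw x hx => ?_⟩
  · have h1 := h.nodup
    rw [Multiset.cons_bind, Multiset.cons_bind, ← add_assoc] at h1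
    rw [Multiset.cons_bind, SPTree.leaves, add_comm S.leaves]
    exact h1
  · rw [← h.kirchhoff w hw x hx]
    simp only [Multiset.map_cons, Multiset.sum_cons]
    rw [← add_assoc, ← add_smul]
    congr 2
    simp only [current, SPTree.weight]
    ring
  · rw [h.flow_eq w hw x hx]
    simp only [Multiset.map_cons, Multiset.sum_cons]
    rw [← add_assoc]
    congr 1
    have hS := SPTree.weight_pos hw S
    have hT := SPTree.weight_pos hw T
    simp only [current, SPTree.weight, SPTree.share, smul_add, smul_smul]
    rw [add_comm]
    congr 2 <;> field_simp

theorem step {N N' : UndirectedMultigraph V} (hstep : ReductionStep p N N')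
    (h : Represents G p M) (hM : M.map ends = N.links) :
    ∃ M', Represents G p M' ∧ M'.map ends = N'.links := by
  rw [← zero_add M] at h
  cases hstep with
  | degreeOne U L v u hvu hp hL =>
    obtain ⟨T, M', h', hM'⟩ := h.exists_cons hM
    rw [zero_add] at h'
    exact ⟨M', h'.degreeOne hvu hp hM' hL, hM'⟩
  | series U L a v b hav hvb hab hp hL =>
    obtain ⟨S, M', h', hM'⟩ := h.exists_cons hM
    rw [zero_add, ← Multiset.singleton_add] at h'
    obtain ⟨T, M'', h'', hM''⟩ := h'.exists_cons hM'
    rw [Multiset.singleton_add] at h''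
    refine ⟨_, h''.series hav hvb hp hM'' hL, ?_⟩
    rw [Multiset.map_cons, hM'']
    rfl
  | parallel U L a b hab =>
    obtain ⟨S, M', h', hM'⟩ := h.exists_cons hM
    rw [zero_add, ← Multiset.singleton_add] at h'
    obtain ⟨T, M'', h'', hM''⟩ := h'.exists_cons hM'
    rw [Multiset.singleton_add] at h''
    refine ⟨_, h''.parallel, ?_⟩
    rw [Multiset.map_cons, hM'']
    rfl

end Represents

/-- A link reducible network is a series-parallel composition of some of its links, and there is no
flow on the remaining ones. -/
theorem exists_spTree (G : DirectedMultigraph V E) (hconn : G.WeaklyConnected) {s t : V}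
    (hst : s ≠ t) (hred : G.LinkReducible (dipole s t)) :
    ∃ T : SPTree E, T.leaves.Nodup ∧ ∀ w : E → ℝ, (∀ i, 0 < w i) →
      G.eqWeight s t w = T.weight w ∧ G.flow w (dipole s t) = T.share w := by
  obtain ⟨N, hN, hcard⟩ := hred
  have hrep : ∃ M, Represents G (dipole s t) M ∧ M.map ends = N.links := by
    clear hcard
    induction hN with
    | refl =>
      refine ⟨_, Represents.initial G _, ?_⟩
      rw [Multiset.map_map]
      rfl
    | tail _ hstep ih =>
      obtain ⟨M, h, hM⟩ := ih
      exact h.step hstep hM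
  obtain ⟨M, hrep, hM⟩ := hrep
  have hM1 : M.card = 1 := by rw [← hcard, ← hM, Multiset.card_map]
  obtain ⟨⟨a, b, T⟩, rfl⟩ := Multiset.card_eq_one.1 hM1
  have hpot : ∀ w : E → ℝ, (∀ i, 0 < w i) → (G.laplacian w).mulVec
      ((pinv (G.laplacian w)).mulVec (dipole s t)) = dipole s t := fun w hw =>
    G.laplacian_mulVec_pinv hconn hw s t
  have hst' : ∃ T, Represents G (dipole s t) {(s, t, T)} := by
    -- Any positive weights serve to identify the end points of the last link.
    have h1 := hrep.kirchhoff (fun _ => 1) (fun _ => one_pos) _ (hpot _ fun _ => one_pos)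
    rw [Multiset.map_singleton, Multiset.sum_singleton] at h1
    rcases eq_of_smul_dipole_eq hst h1 with ⟨h2, h3⟩ | ⟨h2, h3⟩
    · simp only at h2 h3
      subst h2 h3
      exact ⟨T, hrep⟩
    · simp only at h2 h3
      subst h2 h3
      exact ⟨T.rev, hrep.reverse⟩
  obtain ⟨T, hT⟩ := hst'
  refine ⟨T, by simpa using hT.nodup, fun w hw => ?_⟩
  have h1 := hT.kirchhoff w hw _ (hpot w hw)
  rw [Multiset.map_singleton, Multiset.sum_singleton] at h1
  have hcur := congrFun h1 s
  rw [Pi.smul_apply, dipole_apply_left hst, smul_eq_mul, mul_one] at hcur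
  constructor
  · rw [eqWeight, dotProduct_dipole, one_div]
    exact (eq_inv_of_mul_eq_one_left hcur).symm
  · have h2 := hT.flow_eq w hw _ (hpot w hw)
    rw [Multiset.map_singleton, Multiset.sum_singleton, hcur, one_smul] at h2
    rw [← h2]
    funext i
    exact G.flow_apply w _ i

end DirectedMultigraph

/-! ### Capacity functions of series-parallel trees -/

namespace SPTree

variable {E : Type*}

theorem weight_congr {w w' : E → ℝ} (T : SPTree E) (h : ∀ i ∈ T.leaves, w i = w' i) :
    T.weight w = T.weight w' := by
  induction T with
  | leaf i ε => exact h i (Multiset.mem_singleton_self i)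
  | series S T hS hT =>
    simp only [leaves, Multiset.mem_add] at h
    rw [weight, weight, hS fun i hi => h i (Or.inl hi), hT fun i hi => h i (Or.inr hi)]
  | parallel S T hS hT =>
    simp only [leaves, Multiset.mem_add] at h
    rw [weight, weight, hS fun i hi => h i (Or.inl hi), hT fun i hi => h i (Or.inr hi)]

variable [DecidableEq E]

theorem share_congr {w w' : E → ℝ} (T : SPTree E) (h : ∀ i ∈ T.leaves, w i = w' i) :
    T.share w = T.share w' := by
  induction T with
  | leaf i ε => rfl
  | series S T hS hT =>
    simp only [leaves, Multiset.mem_add] at h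
    rw [share, share, hS fun i hi => h i (Or.inl hi), hT fun i hi => h i (Or.inr hi)]
  | parallel S T hS hT =>
    simp only [leaves, Multiset.mem_add] at h
    rw [share, share, hS fun i hi => h i (Or.inl hi), hT fun i hi => h i (Or.inr hi),
      S.weight_congr fun i hi => h i (Or.inl hi), T.weight_congr fun i hi => h i (Or.inr hi)]

theorem share_eq_zero (w : E → ℝ) (T : SPTree E) {i : E} (hi : i ∉ T.leaves) :
    T.share w i = 0 := by
  induction T with
  | leaf j ε => exact Pi.single_eq_of_ne (fun h => hi (Multiset.mem_singleton.2 h)) _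
  | series S T hS hT =>
    simp only [leaves, Multiset.mem_add, not_or] at hi
    simp [share, hS hi.1, hT hi.2]
  | parallel S T hS hT =>
    simp only [leaves, Multiset.mem_add, not_or] at hi
    simp [share, hS hi.1, hT hi.2]

section Components

variable {S T : SPTree E} {w : E → ℝ} {i : E}

theorem share_series_left (h : Disjoint S.leaves T.leaves) (hi : i ∈ S.leaves) :
    (S.series T).share w i = S.share w i := by
  rw [share, Pi.add_apply, T.share_eq_zero w (Multiset.disjoint_left.1 h hi), add_zero]

theorem share_series_right (h : Disjoint S.leaves T.leaves) (hi : i ∈ T.leaves) :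
    (S.series T).share w i = T.share w i := by
  rw [share, Pi.add_apply, S.share_eq_zero w (Multiset.disjoint_right.1 h hi), zero_add]

theorem share_parallel_left (h : Disjoint S.leaves T.leaves) (hi : i ∈ S.leaves) :
    (S.parallel T).share w i = S.weight w / (S.weight w + T.weight w) * S.share w i := by
  simp [share, T.share_eq_zero w (Multiset.disjoint_left.1 h hi)]

theorem share_parallel_right (h : Disjoint S.leaves T.leaves) (hi : i ∈ T.leaves) :
    (S.parallel T).share w i = T.weight w / (S.weight w + T.weight w) * T.share w i := by
  simp [share, S.share_eq_zero w (Multiset.disjoint_right.1 h hi)]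

end Components

/-- The direction of the flow on a link of a composition does not depend on the weights. -/
theorem exists_sign {T : SPTree E} (hT : T.leaves.Nodup) {i : E} (hi : i ∈ T.leaves) :
    (∀ w : E → ℝ, (∀ i, 0 < w i) → 0 < T.share w i) ∨
      ∀ w : E → ℝ, (∀ i, 0 < w i) → T.share w i < 0 := by
  induction T with
  | leaf j ε =>
    obtain rfl := Multiset.mem_singleton.1 hi
    rcases Int.units_eq_one_or ε with rfl | rfl
    · exact Or.inl fun w _ => by simp [share]
    · exact Or.inr fun w _ => by simp [share]
  | series S T hS hT' =>
    obtain ⟨h1, h2, h3⟩ := Multiset.nodup_add.1 hT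
    rcases Multiset.mem_add.1 hi with hi | hi
    · simpa only [share_series_left h3 hi] using hS h1 hi
    · simpa only [share_series_right h3 hi] using hT' h2 hi
  | parallel S T hS hT' =>
    obtain ⟨h1, h2, h3⟩ := Multiset.nodup_add.1 hT
    rcases Multiset.mem_add.1 hi with hi | hi
    · simp only [share_parallel_left h3 hi]
      exact (hS h1 hi).imp
        (fun h w hw => mul_pos (div_pos (S.weight_pos hw)
          (add_pos (S.weight_pos hw) (T.weight_pos hw))) (h w hw))
        (fun h w hw => mul_neg_of_pos_of_neg (div_pos (S.weight_pos hw)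
          (add_pos (S.weight_pos hw) (T.weight_pos hw))) (h w hw))
    · simp only [share_parallel_right h3 hi]
      exact (hT' h2 hi).imp
        (fun h w hw => mul_pos (div_pos (T.weight_pos hw)
          (add_pos (S.weight_pos hw) (T.weight_pos hw))) (h w hw))
        (fun h w hw => mul_neg_of_pos_of_neg (div_pos (T.weight_pos hw)
          (add_pos (S.weight_pos hw) (T.weight_pos hw))) (h w hw))

/-- A flow `z` through the composition `T` with the equivalent weight `h` is possible for some
weights within the bounds. -/
def Feasible (wl wu : E → ℝ) (c : E → ℝ → ℝ) (T : SPTree E) (h z : ℝ) : Prop :=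
  ∃ w : E → ℝ, (∀ i, wl i ≤ w i ∧ w i ≤ wu i) ∧
    (∀ i ∈ T.leaves, z * |T.share w i| ≤ c i (w i)) ∧ T.weight w = h

/-- Disjoint leaves let the weights of the two parts be chosen independently. -/
theorem exists_glue {wl wu : E → ℝ} {S T : SPTree E} (h : Disjoint S.leaves T.leaves)
    {w₁ w₂ : E → ℝ} (h₁ : ∀ i, wl i ≤ w₁ i ∧ w₁ i ≤ wu i) (h₂ : ∀ i, wl i ≤ w₂ i ∧ w₂ i ≤ wu i) :
    ∃ w : E → ℝ, (∀ i, wl i ≤ w i ∧ w i ≤ wu i) ∧ (∀ i ∈ S.leaves, w i = w₁ i) ∧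
      ∀ i ∈ T.leaves, w i = w₂ i := by
  refine ⟨fun i => if i ∈ S.leaves then w₁ i else w₂ i, fun i => ?_, fun i hi => if_pos hi,
    fun i hi => if_neg (Multiset.disjoint_right.1 h hi)⟩
  beta_reduce
  split_ifs
  exacts [h₁ i, h₂ i]

variable {wl wu : E → ℝ} {c : E → ℝ → ℝ}

theorem feasible_leaf_iff (hwlu : ∀ i, wl i ≤ wu i) (i : E) (ε : ℤˣ) (h z : ℝ) :
    Feasible wl wu c (leaf i ε) h z ↔ h ∈ Set.Icc (wl i) (wu i) ∧ z ≤ c i h := by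
  have hs : ∀ w : E → ℝ, |(leaf i ε).share w i| = 1 := fun w => by
    rcases Int.units_eq_one_or ε with rfl | rfl <;> simp [share]
  constructor
  · rintro ⟨w, hw, hc, rfl⟩
    have := hc i (Multiset.mem_singleton_self i)
    rw [hs, mul_one] at this
    exact ⟨hw i, this⟩
  · rintro ⟨hh, hz⟩
    -- The other weights do not matter; the lower bounds are a default within range.
    refine ⟨Function.update wl i h, fun j => ?_, fun j hj => ?_, by simp [weight]⟩
    · rcases eq_or_ne j i with rfl | hne
      · rw [Function.update_self]
        exact hh
      · rw [Function.update_of_ne hne]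
        exact ⟨le_rfl, hwlu j⟩
    · obtain rfl := Multiset.mem_singleton.1 hj
      rwa [hs, mul_one, Function.update_self]

theorem feasible_series_iff {S T : SPTree E} (hd : Disjoint S.leaves T.leaves) (h z : ℝ) :
    Feasible wl wu c (S.series T) h z ↔ ∃ x₁ x₂, (x₁⁻¹ + x₂⁻¹)⁻¹ = h ∧
      Feasible wl wu c S x₁ z ∧ Feasible wl wu c T x₂ z := by
  constructor
  · rintro ⟨w, hw, hc, rfl⟩
    refine ⟨_, _, rfl, ⟨w, hw, fun i hi => ?_, rfl⟩, ⟨w, hw, fun i hi => ?_, rfl⟩⟩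
    · have := hc i (Multiset.mem_add.2 (Or.inl hi))
      rwa [share_series_left hd hi] at this
    · have := hc i (Multiset.mem_add.2 (Or.inr hi))
      rwa [share_series_right hd hi] at this
  · rintro ⟨_, _, rfl, ⟨w₁, hw₁, hc₁, rfl⟩, ⟨w₂, hw₂, hc₂, rfl⟩⟩
    obtain ⟨w, hw, e₁, e₂⟩ := exists_glue hd hw₁ hw₂
    refine ⟨w, hw, fun i hi => ?_, by rw [weight, S.weight_congr e₁, T.weight_congr e₂]⟩
    rcases Multiset.mem_add.1 hi with hi | hi
    · rw [share_series_left hd hi, S.share_congr e₁, e₁ i hi]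
      exact hc₁ i hi
    · rw [share_series_right hd hi, T.share_congr e₂, e₂ i hi]
      exact hc₂ i hi

theorem feasible_parallel_iff (hwl : ∀ i, 0 < wl i) {S T : SPTree E}
    (hd : Disjoint S.leaves T.leaves) (h z : ℝ) :
    Feasible wl wu c (S.parallel T) h z ↔ ∃ x₁ x₂, x₁ + x₂ = h ∧
      Feasible wl wu c S x₁ (z * (x₁ / (x₁ + x₂))) ∧
      Feasible wl wu c T x₂ (z * (x₂ / (x₁ + x₂))) := by
  have hratio : ∀ w : E → ℝ, (∀ i, wl i ≤ w i ∧ w i ≤ wu i) →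
      0 ≤ S.weight w / (S.weight w + T.weight w) ∧
      0 ≤ T.weight w / (S.weight w + T.weight w) := fun w hw => by
    have hw0 : ∀ i, 0 < w i := fun i => (hwl i).trans_le (hw i).1
    have hS := S.weight_pos hw0
    have hT := T.weight_pos hw0
    constructor <;> positivity
  constructor
  · rintro ⟨w, hw, hc, rfl⟩
    refine ⟨_, _, rfl, ⟨w, hw, fun i hi => ?_, rfl⟩, ⟨w, hw, fun i hi => ?_, rfl⟩⟩
    · have := hc i (Multiset.mem_add.2 (Or.inl hi))
      rwa [share_parallel_left hd hi, abs_mul, abs_of_nonneg (hratio w hw).1, ← mul_assoc] at this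
    · have := hc i (Multiset.mem_add.2 (Or.inr hi))
      rwa [share_parallel_right hd hi, abs_mul, abs_of_nonneg (hratio w hw).2, ← mul_assoc] at this
  · rintro ⟨_, _, rfl, ⟨w₁, hw₁, hc₁, rfl⟩, ⟨w₂, hw₂, hc₂, rfl⟩⟩
    obtain ⟨w, hw, e₁, e₂⟩ := exists_glue hd hw₁ hw₂
    rw [← S.weight_congr e₁, ← T.weight_congr e₂] at *
    refine ⟨w, hw, fun i hi => ?_, by rw [weight]⟩
    rcases Multiset.mem_add.1 hi with hi | hi
    · rw [share_parallel_left hd hi, abs_mul, abs_of_nonneg (hratio w hw).1, ← mul_assoc,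
        S.share_congr e₁, e₁ i hi]
      exact hc₁ i hi
    · rw [share_parallel_right hd hi, abs_mul, abs_of_nonneg (hratio w hw).2, ← mul_assoc,
        T.share_congr e₂, e₂ i hi]
      exact hc₂ i hi

/-- Describing the whole hypograph, rather than a maximum, lets the two composition theorems be
chained along the tree. -/
theorem exists_isCapacity (hwl : ∀ i, 0 < wl i) (hwlu : ∀ i, wl i ≤ wu i)
    (hc : ∀ i, IsCapacity (wl i) (wu i) (c i)) {T : SPTree E} (hT : T.leaves.Nodup) :
    ∃ C, IsCapacity (T.weight wl) (T.weight wu) C ∧ ∀ h z,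
      Feasible wl wu c T h z ↔ h ∈ Set.Icc (T.weight wl) (T.weight wu) ∧ z ≤ C h := by
  induction T with
  | leaf i ε => exact ⟨c i, hc i, feasible_leaf_iff hwlu i ε⟩
  | series S T hS hT' =>
    obtain ⟨h1, h2, h3⟩ := Multiset.nodup_add.1 hT
    obtain ⟨C₁, hC₁, f₁⟩ := hS h1
    obtain ⟨C₂, hC₂, f₂⟩ := hT' h2
    obtain ⟨C, hC, f⟩ := hC₁.exists_series hC₂
    refine ⟨C, hC, fun h z => ?_⟩
    rw [feasible_series_iff h3]
    refine Iff.trans ?_ (f h z)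
    simp only [f₁, f₂]
    grind
  | parallel S T hS hT' =>
    obtain ⟨h1, h2, h3⟩ := Multiset.nodup_add.1 hT
    obtain ⟨C₁, hC₁, f₁⟩ := hS h1
    obtain ⟨C₂, hC₂, f₂⟩ := hT' h2
    obtain ⟨C, hC, f⟩ := hC₁.exists_parallel hC₂
    refine ⟨C, hC, fun h z => ?_⟩
    rw [feasible_parallel_iff hwl h3]
    refine Iff.trans ?_ (f h z)
    simp only [f₁, f₂]
    constructor
    · rintro ⟨x₁, x₂, hx, ⟨m₁, n₁⟩, m₂, n₂⟩
      exact ⟨x₁, m₁, x₂, m₂, hx, n₁, n₂⟩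
    · rintro ⟨x₁, m₁, x₂, m₂, hx, n₁, n₂⟩
      exact ⟨x₁, x₂, hx, ⟨m₁, n₁⟩, m₂, n₂⟩

end SPTree

/-! ### The reduction problem of the network -/

theorem mainTheorem8 {V E : Type*} [Fintype V] [DecidableEq V] [Fintype E] [DecidableEq E]
    (G : DirectedMultigraph V E) (hconn : G.WeaklyConnected)
    (s t : V) (hst : s ≠ t) (hred : G.LinkReducible (dipole s t))
    (horient : ∃ w₀ : E → ℝ, (∀ i, 0 < w₀ i) ∧ ∀ i, 0 ≤ G.flow w₀ (dipole s t) i)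
    (wl wu : E → ℝ) (hwl : ∀ i, 0 < wl i) (hwlu : ∀ i, wl i ≤ wu i)
    (c : E → ℝ → ℝ) (hcpos : ∀ i, ∀ x ∈ Set.Icc (wl i) (wu i), 0 < c i x)
    (hcS1 : ∀ i, IsS1 (wl i) (wu i) (c i)) :
    (∀ weq ∈ Set.Icc (G.eqWeight s t wl) (G.eqWeight s t wu),
      IsGreatest (G.reductionFeasible s t wl wu c weq)
        (G.equivalentCapacity s t wl wu c weq)) ∧
    IsS1 (G.eqWeight s t wl) (G.eqWeight s t wu) (G.equivalentCapacity s t wl wu c) := by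
  obtain ⟨T, hT, hTG⟩ := G.exists_spTree hconn hst hred
  obtain ⟨C, hC, hfeas⟩ :=
    SPTree.exists_isCapacity hwl hwlu (fun i => (hcS1 i).isCapacity (hcpos i)) hT
  have hwu : ∀ i, 0 < wu i := fun i => (hwl i).trans_le (hwlu i)
  -- The sign of each flow is the same for all weights, so the orientation at `w₀` fixes it.
  have hnn : ∀ w : E → ℝ, (∀ i, 0 < w i) → ∀ i ∈ T.leaves, 0 ≤ T.share w i := by
    intro w hw i hi
    obtain ⟨w₀, hw₀, h₀⟩ := horient
    rcases SPTree.exists_sign hT hi with h | h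
    · exact (h w hw).le
    · have := h₀ i
      rw [(hTG w₀ hw₀).2] at this
      exact absurd (h w₀ hw₀) (not_lt.2 this)
  rw [(hTG wl hwl).1, (hTG wu hwu).1]
  -- With nonnegative shares the absolute values in `SPTree.Feasible` disappear. The feasible set is
  -- a closed half-line, so its supremum is attained.
  have hset : ∀ weq ∈ Set.Icc (T.weight wl) (T.weight wu),
      G.reductionFeasible s t wl wu c weq = Set.Iic (C weq) := by
    intro weq hweq
    ext z
    rw [Set.mem_Iic, ← and_iff_right hweq (b := z ≤ C weq), ← hfeas]
    refine exists_congr fun w => and_congr_right fun hw => ?_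
    have hw0 : ∀ i, 0 < w i := fun i => (hwl i).trans_le (hw i).1
    rw [(hTG w hw0).1, (hTG w hw0).2]
    refine and_congr_left fun _ => ⟨fun h i hi => ?_, fun h i => ?_⟩
    · rw [abs_of_nonneg (hnn w hw0 i hi)]
      exact h i
    · by_cases hi : i ∈ T.leaves
      · rw [← abs_of_nonneg (hnn w hw0 i hi)]
        exact h i hi
      -- A link outside the tree carries no flow, and its constraint reads `0 ≤ cᵢ`.
      · rw [T.share_eq_zero w hi, mul_zero]
        exact (hcpos i _ (hw i)).le
  have hcap : ∀ weq ∈ Set.Icc (T.weight wl) (T.weight wu),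
      G.equivalentCapacity s t wl wu c weq = C weq := by
    intro weq hweq
    rw [DirectedMultigraph.equivalentCapacity, hset weq hweq, csSup_Iic]
  refine ⟨fun weq hweq => ?_, (hC.congr fun x hx => (hcap x hx).symm).isS1⟩
  rw [hcap weq hweq, hset weq hweq]
  exact isGreatest_Iic
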